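/- Consider the continuous review $(r,q)$ inventory system with lost sales: customers arrive according to a Poisson process of rate $\lambda>0$ and demand one unit each; a demand is served if there is stock on hand and is lost otherwise; whenever the inventory position (units on hand plus units in outstanding orders) drops to the reorder point $r\in\{0,1,2,\dots\}$, an order for $q\ge 1$ units is placed, which is delivered after the constant lead time $\tau>0$. Several orders may be outstanding at once. The system starts at time $0$ in any state with inventory position in $\{r+1,\dots,r+q\}$ and outstanding orders, each for $q$ units, with remaining lead times in $(0,\tau]$. Put $x=\lambda\tau$. Almost surely, whatever the initial state, the following long-run time averages exist and are constants that depend only on $r,q,\lambda,\tau$: the fraction $\gamma$ of time with no stock on hand, the average on-hand inventory $L$, the average inventory position $P$, and the average number $U$ of units in outstanding orders. They satisfy (a) $P=(1-\gamma)\left(r+\frac{q+1}{2}\right)+\gamma q\left\lfloor\frac{r+q}{q}\right\rfloor$; (b) $L=P-U$; (c) $U=(1-\gamma)x$; (d) $L=(1-\gamma)\left(r+\frac{q+1}{2}-x\right)+\gamma q\left\lfloor\frac{r+q}{q}\right\rfloor$. For given $r,q,x$, these relations determine all four quantities from any one of them: always from $\gamma$ and from $U$; from $P$ provided that $r+\frac{q+1}{2}\ne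 q\left\lfloor\frac{r+q}{q}\right\rfloor$; and from $L$ provided that $r+\frac{q+1}{2}-x\ne q\left\lfloor\frac{r+q}{q}\right\rfloor$. (In the two excluded cases $P$, respectively $L$, equals $q\left\lfloor\frac{r+q}{q}\right\rfloor$ whatever the value of $\gamma$.) -/

import Mathlib

open MeasureTheory ProbabilityTheory Filter Topology

noncomputable section

namespace LostSales

/-- State of an `(r, q)` lost sales system with constant lead time at some epoch: the number of
units on hand, and the remaining lead times of the outstanding replenishment orders (each order
being for `q` units). -/
@[ext]
structure State where
  onHand : ℕ
  outstanding : List ℝ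

/-- Number of units in outstanding orders. -/
def State.onOrder (q : ℕ) (s : State) : ℕ := q * s.outstanding.length

/-- Inventory position: units on hand plus units in outstanding orders. -/
def State.position (q : ℕ) (s : State) : ℕ := s.onHand + s.onOrder q

/-- The possible states of the `(r, q)` system with lead time `τ`: the inventory position is one of
`r + 1, …, r + q`, and every outstanding order has a remaining lead time in `(0, τ]`. -/
def State.Admissible (r q : ℕ) (τ : ℝ) (s : State) : Prop :=
  r < s.position q ∧ s.position q ≤ r + q ∧ ∀ y ∈ s.outstanding, 0 < y ∧ y ≤ τ

/-- The state after `t` units of time during which no customer arrives: the orders with remaining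
lead time at most `t` have been delivered. -/
def State.elapse (q : ℕ) (t : ℝ) (s : State) : State where
  onHand := s.onHand + q * s.outstanding.countP (fun y => decide (y ≤ t))
  outstanding := (s.outstanding.filter (fun y => decide (t < y))).map (fun y => y - t)

/-- The arrival of a customer who demands one unit. If there is no stock on hand the demand is
lost. Otherwise it is served, and if the inventory position thereby drops to the reorder point `r`,
an order for `q` units with lead time `τ` is placed at once. -/
def State.demand (r q : ℕ) (τ : ℝ) (s : State) : State :=
  if s.onHand = 0 then s
  else if s.position q - 1 ≤ r then ⟨s.onHand - 1, s.outstanding ++ [τ]⟩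
  else ⟨s.onHand - 1, s.outstanding⟩

/-- Arrival epoch of the `n`-th customer (`n ≥ 1`) when the successive interarrival times are
`a 0, a 1, …`; `arrival a 0 = 0` is the initial epoch. -/
def arrival (a : ℕ → ℝ) (n : ℕ) : ℝ := ∑ i ∈ Finset.range n, a i

/-- Number of customers that have arrived up to and including epoch `t`. -/
def arrivals (a : ℕ → ℝ) (t : ℝ) : ℕ := {n : ℕ | arrival a (n + 1) ≤ t}.ncard

/-- The state just after the arrival of the `n`-th customer (the initial state if `n = 0`). -/
def stateAfter (r q : ℕ) (τ : ℝ) (s₀ : State) (a : ℕ → ℝ) : ℕ → State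
  | 0 => s₀
  | n + 1 => ((stateAfter r q τ s₀ a n).elapse q (a n)).demand r q τ

/-- The sample path of the system: its state at epoch `t`, when it starts in `s₀` at epoch `0` and
the interarrival times of the customers are `a 0, a 1, …`. -/
def path (r q : ℕ) (τ : ℝ) (s₀ : State) (a : ℕ → ℝ) (t : ℝ) : State :=
  (stateAfter r q τ s₀ a (arrivals a t)).elapse q (t - arrival a (arrivals a t))

/-- The customer arrivals form a Poisson process of rate `lam`: the interarrival times
`X 0, X 1, …` are independent and exponentially distributed with parameter `lam`. -/
structure IsPoissonDemand {Ω : Type*} [MeasurableSpace Ω] (μ : Measure Ω) (lam : ℝ)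
    (X : ℕ → Ω → ℝ) : Prop where
  hasLaw : ∀ n, HasLaw (X n) (expMeasure lam) μ
  indep : iIndepFun X μ

/-- The function `f` of time (integrable on bounded intervals) has the long run time average `m`:
`(1 / T) ∫₀ᵀ f(t) dt → m` as `T → ∞`. -/
def HasLongRunAverage (f : ℝ → ℝ) (m : ℝ) : Prop :=
  (∀ T : ℝ, 0 ≤ T → IntervalIntegrable f volume 0 T) ∧
    Tendsto (fun T : ℝ => (1 / T) * ∫ t in (0 : ℝ)..T, f t) atTop (𝓝 m)

/-- Mean of the uniform distribution on `r + 1, …, r + q`. -/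
def meanPosition (r q : ℕ) : ℝ := r + (q + 1) / 2

/-- The number `q ⌊(r + q) / q⌋`. -/
def stockoutPosition (r q : ℕ) : ℝ := q * ⌊((r : ℝ) + q) / q⌋

/-- The four relations between the stockout time fraction `γ`, the average on hand inventory `L`,
the average inventory position `P` and the average number `U` of units on order. -/
def Relations (r q : ℕ) (x γ L P U : ℝ) : Prop :=
  P = (1 - γ) * meanPosition r q + γ * stockoutPosition r q ∧
  L = P - U ∧
  U = (1 - γ) * x ∧
  L = (1 - γ) * (meanPosition r q - x) + γ * stockoutPosition r q

end LostSales

end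

/-!
The sequence of interarrival times is i.i.d. and drives a deterministic recursion for the state seen
by the successive customers. The proof has three ingredients.

*Existence of the averages.* A gap of at least one lead time, followed by `r + q` customers within
less than one lead time and by another such gap, empties the stock and then leaves a state that does
not depend on the past (`stateAfter_eq_of_clearing`). Such clearing patterns have positive
probability. Hence, up to an error that is small on average, the state seen by a customer is a
function of a fixed number `M` of preceding gaps, obtained by starting the system afresh `M`
customers earlier. For functions of finitely many consecutive gaps the strong law of large numbers
holds (`tendsto_average_shift`), and `M → ∞` gives averages over the customers that are common to all
initial states (`exists_customer_average`).

*Arrivals see time averages.* For a bounded measurable `g` and an exponential time `T` of rate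
`lam`, `lam * 𝔼 ∫₀ᵀ g = 𝔼 g(T)`. As a gap is independent of the state at its start, the average of a
function of the state over time equals its average over the states that the customers find
(`exists_average_of_observable`). A renewal-reward argument passes from sums over customers to
integrals over time (`hasLongRunAverage_of_customer_averages`).

*The relations.* They follow from balance equations on a sample path (`relations_of_averages`).
Served demands take the inventory position around the cycle `r + q, …, r + 1`, so customers who find
stock find each position equally often; during a stockout the position is the only multiple of `q`
in that range. The total remaining lead time grows by `τ` with each order and runs off at a rate
equal to the number of outstanding orders, which is Little's law for the units on order.
-/

namespace LostSales

section

/-! ### Dynamics of the inventory state -/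

variable {r q : ℕ} {τ : ℝ}

lemma length_filter_add_countP (l : List ℝ) (t : ℝ) :
    (l.filter (fun y => decide (t < y))).length + l.countP (fun y => decide (y ≤ t)) =
      l.length := by
  induction l with
  | nil => simp
  | cons y l ih =>
    by_cases h : t < y
    · simp [h, not_le.2 h] at ih ⊢; omega
    · simp [h, not_lt.1 h] at ih ⊢; omega

lemma position_elapse (s : State) (t : ℝ) : (s.elapse q t).position q = s.position q := by
  have h := length_filter_add_countP s.outstanding t
  simp only [State.position, State.onOrder, State.elapse, List.length_map]
  rw [← h]; ring

lemma State.Admissible.elapse {s : State} (hs : s.Admissible r q τ) {t : ℝ} (ht : 0 ≤ t) :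
    (s.elapse q t).Admissible r q τ := by
  refine ⟨by rw [position_elapse]; exact hs.1, by rw [position_elapse]; exact hs.2.1, ?_⟩
  intro y hy
  simp only [State.elapse, List.mem_map, List.mem_filter, decide_eq_true_eq] at hy
  obtain ⟨z, ⟨hz, htz⟩, rfl⟩ := hy
  have := hs.2.2 z hz
  constructor <;> linarith

/-- Level crossing: a demand that is served moves the position one step down the cycle
`r + q, …, r + 1, r + q, …`. -/
lemma position_demand {s : State} (hs : s.Admissible r q τ) :
    (s.demand r q τ).position q =
      if s.onHand = 0 then s.position q
      else if s.position q = r + 1 then r + q else s.position q - 1 := by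
  obtain ⟨h1, h2, -⟩ := hs
  unfold State.demand
  by_cases h0 : s.onHand = 0
  · simp [h0]
  · by_cases hp : s.position q = r + 1
    · have hp' : s.position q - 1 ≤ r := by omega
      rw [if_neg h0, if_pos hp', if_neg h0, if_pos hp]
      simp only [State.position, State.onOrder, List.length_append, List.length_singleton,
        mul_add, mul_one] at *
      omega
    · have hp' : ¬ s.position q - 1 ≤ r := by omega
      rw [if_neg h0, if_neg hp', if_neg h0, if_neg hp]
      simp only [State.position, State.onOrder] at *
      omega

lemma State.Admissible.demand (hq : 0 < q) (hτ : 0 < τ) {s : State}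
    (hs : s.Admissible r q τ) : (s.demand r q τ).Admissible r q τ := by
  have hp := position_demand hs
  obtain ⟨h1, h2, h3⟩ := hs
  have hpos : r < (s.demand r q τ).position q ∧ (s.demand r q τ).position q ≤ r + q := by
    rw [hp]; split_ifs <;> omega
  refine ⟨hpos.1, hpos.2, ?_⟩
  intro y hy
  unfold State.demand at hy
  split_ifs at hy
  · exact h3 y hy
  · simp only [List.mem_append, List.mem_singleton] at hy
    rcases hy with hy | rfl
    · exact h3 y hy
    · exact ⟨hτ, le_rfl⟩
  · exact h3 y hy

lemma admissible_full (hq : 0 < q) : (State.mk (r + q) []).Admissible r q τ := by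
  simp [State.Admissible, State.position, State.onOrder, hq]

lemma onHand_le {s : State} (hs : s.Admissible r q τ) : s.onHand ≤ r + q := by
  have := hs.2.1
  simp only [State.position] at this
  omega

lemma onOrder_le {s : State} (hs : s.Admissible r q τ) : s.onOrder q ≤ r + q := by
  have := hs.2.1
  simp only [State.position] at this
  omega

/-- During a stockout the whole position is on order, so it is the unique multiple of `q` among
`r + 1, …, r + q`. -/
lemma position_of_onHand_eq_zero {s : State} (hs : s.Admissible r q τ) (h0 : s.onHand = 0) :
    s.position q = q * ((r + q) / q) := by
  obtain ⟨h1, h2, -⟩ := hs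
  simp only [State.position, State.onOrder, h0, zero_add] at *
  congr 1
  have hq : 0 < q := by rcases Nat.eq_zero_or_pos q with rfl | h <;> simp_all
  symm
  rw [Nat.div_eq_iff hq]
  constructor
  · rw [mul_comm]; exact h2
  · rw [mul_comm]; omega

/-- The state seen by the `k + 1`-st customer, just before his demand. -/
noncomputable def stateBefore (r q : ℕ) (τ : ℝ) (s₀ : State) (a : ℕ → ℝ) (k : ℕ) : State :=
  (stateAfter r q τ s₀ a k).elapse q (a k)

lemma stateAfter_succ (s₀ : State) (a : ℕ → ℝ) (k : ℕ) :
    stateAfter r q τ s₀ a (k + 1) = (stateBefore r q τ s₀ a k).demand r q τ := rfl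

lemma stateAfter_add (s₀ : State) (a : ℕ → ℝ) (n m : ℕ) :
    stateAfter r q τ s₀ a (n + m) =
      stateAfter r q τ (stateAfter r q τ s₀ a n) (fun i => a (n + i)) m := by
  induction m with
  | zero => rfl
  | succ m ih => rw [← add_assoc, stateAfter, stateAfter, ih]

lemma stateAfter_congr (s₀ : State) {a b : ℕ → ℝ} {n : ℕ} (h : ∀ i < n, a i = b i) :
    stateAfter r q τ s₀ a n = stateAfter r q τ s₀ b n := by
  induction n with
  | zero => rfl
  | succ n ih => rw [stateAfter, stateAfter, ih fun i hi => h i (by omega), h n (by omega)]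

lemma admissible_stateAfter (hq : 0 < q) (hτ : 0 < τ) {s₀ : State} (hs : s₀.Admissible r q τ)
    {a : ℕ → ℝ} (ha : ∀ n, 0 < a n) (n : ℕ) : (stateAfter r q τ s₀ a n).Admissible r q τ := by
  induction n with
  | zero => exact hs
  | succ n ih => exact (ih.elapse (ha n).le).demand hq hτ

lemma admissible_stateBefore (hq : 0 < q) (hτ : 0 < τ) {s₀ : State} (hs : s₀.Admissible r q τ)
    {a : ℕ → ℝ} (ha : ∀ n, 0 < a n) (n : ℕ) : (stateBefore r q τ s₀ a n).Admissible r q τ :=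
  (admissible_stateAfter hq hτ hs ha n).elapse (ha n).le

/-! ### Clearing patterns couple all initial states -/

lemma elapse_of_forall_le {s : State} {t : ℝ} (h : ∀ y ∈ s.outstanding, y ≤ t) :
    s.elapse q t = ⟨s.position q, []⟩ := by
  have h1 : s.outstanding.filter (fun y => decide (t < y)) = [] := by
    rw [List.filter_eq_nil_iff]
    intro y hy
    simpa using h y hy
  have h2 := position_elapse (q := q) s t
  ext1
  · rw [← h2]; simp [State.elapse, State.position, State.onOrder, h1]
  · simp [State.elapse, h1]

lemma elapse_of_forall_lt {s : State} {t : ℝ} (h : ∀ y ∈ s.outstanding, t < y) :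
    s.elapse q t = ⟨s.onHand, s.outstanding.map (fun y => y - t)⟩ := by
  have h1 : s.outstanding.filter (fun y => decide (t < y)) = s.outstanding := by
    rw [List.filter_eq_self]
    intro y hy
    simpa using h y hy
  have h2 : s.outstanding.countP (fun y => decide (y ≤ t)) = 0 := by
    rw [List.countP_eq_zero]
    intro y hy
    simpa using h y hy
  ext1 <;> simp [State.elapse, h1, h2]

lemma onHand_demand (s : State) : (s.demand r q τ).onHand = s.onHand - 1 := by
  unfold State.demand
  split_ifs <;> simp_all

lemma mem_outstanding_demand {s : State} {y : ℝ} (hy : y ∈ (s.demand r q τ).outstanding) :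
    y ∈ s.outstanding ∨ y = τ := by
  unfold State.demand at hy
  split_ifs at hy <;> simp_all

/-- The interarrival times allowed at place `i` of a clearing pattern. -/
def clearingSet (r q : ℕ) (τ : ℝ) (i : ℕ) : Set ℝ :=
  if 1 ≤ i ∧ i ≤ r + q then Set.Ioc 0 (τ / (r + q + 1)) else Set.Ici τ

/-- A clearing pattern: a gap of at least one lead time, which brings in all outstanding orders,
then `r + q` customers within less than one lead time, who take all the stock, then another gap of
at least one lead time. -/
def Clearing (r q : ℕ) (τ : ℝ) (a : ℕ → ℝ) : Prop :=
  ∀ i ∈ Finset.range (r + q + 2), a i ∈ clearingSet r q τ i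

lemma onHand_le_of_clearing (hq : 0 < q) (hτ : 0 < τ) {s : State} (hs : s.Admissible r q τ)
    {a : ℕ → ℝ} (ha : Clearing r q τ a) {i : ℕ} (hi : i ≤ r + q) :
    (stateAfter r q τ s a (1 + i)).onHand ≤ r + q - 1 - i ∧
      ∀ y ∈ (stateAfter r q τ s a (1 + i)).outstanding, τ - i * (τ / (r + q + 1)) ≤ y := by
  induction i with
  | zero =>
    have h0 : τ ≤ a 0 := by simpa [clearingSet] using ha 0 (by simp)
    have he : s.elapse q (a 0) = ⟨s.position q, []⟩ :=
      elapse_of_forall_le fun y hy => (hs.2.2 y hy).2.trans h0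
    have h2 := hs.2.1
    simp only [stateAfter, he, onHand_demand]
    refine ⟨by omega, fun y hy => ?_⟩
    rcases mem_outstanding_demand hy with h | rfl
    · simp at h
    · simp
  | succ i ih =>
    obtain ⟨ih1, ih2⟩ := ih (by omega)
    have hai : a (1 + i) ∈ Set.Ioc 0 (τ / (r + q + 1)) := by
      have := ha (1 + i) (by simp; omega)
      rwa [clearingSet, if_pos (by omega)] at this
    set δ := τ / ((r : ℝ) + q + 1) with hδ
    have hδ0 : 0 < δ := by positivity
    have hδτ : ((i : ℝ) + 1) * δ < τ := by
      have h1 : ((r : ℝ) + q + 1) * δ = τ := by rw [hδ]; field_simp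
      have h2 : ((i : ℝ) + 1) ≤ r + q := by exact_mod_cast hi
      nlinarith
    have he := elapse_of_forall_lt (q := q) (s := stateAfter r q τ s a (1 + i)) (t := a (1 + i))
      fun y hy => by have := ih2 y hy; linarith [hai.2]
    rw [← add_assoc, stateAfter, he, onHand_demand]
    refine ⟨by dsimp only; omega, fun y hy => ?_⟩
    push_cast
    rcases mem_outstanding_demand hy with h | rfl
    · simp only [List.mem_map] at h
      obtain ⟨z, hz, rfl⟩ := h
      have := ih2 z hz
      linarith [hai.2]
    · nlinarith

lemma pos_of_mem_clearingSet (hτ : 0 < τ) {i : ℕ} {t : ℝ} (h : t ∈ clearingSet r q τ i) :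
    0 < t := by
  unfold clearingSet at h
  split_ifs at h
  · exact h.1
  · exact hτ.trans_le h

/-- After a clearing pattern the state is the same from every initial state. -/
lemma stateAfter_eq_of_clearing (hq : 0 < q) (hτ : 0 < τ) {s s' : State}
    (hs : s.Admissible r q τ) (hs' : s'.Admissible r q τ) {a : ℕ → ℝ} (ha : Clearing r q τ a) :
    stateAfter r q τ s a (r + q + 2) = stateAfter r q τ s' a (r + q + 2) := by
  have key : ∀ u : State, u.Admissible r q τ →
      (stateAfter r q τ u a (1 + (r + q))).elapse q (a (1 + (r + q))) =
        ⟨q * ((r + q) / q), []⟩ := by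
    intro u hu
    have hadm : (stateAfter r q τ u a (1 + (r + q))).Admissible r q τ := by
      rw [stateAfter_congr (b := fun i => if i < r + q + 2 then a i else 1)
        u (fun i hi => by rw [if_pos (by omega)])]
      refine admissible_stateAfter hq hτ hu (fun n => ?_) _
      split_ifs with h
      · exact pos_of_mem_clearingSet hτ (ha n (by simpa using h))
      · exact one_pos
    have h0 : (stateAfter r q τ u a (1 + (r + q))).onHand = 0 := by
      have := (onHand_le_of_clearing hq hτ hu ha le_rfl).1
      omega
    have hlast : τ ≤ a (1 + (r + q)) := by
      have := ha (1 + (r + q)) (by simp; omega)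
      rwa [clearingSet, if_neg (by omega)] at this
    rw [elapse_of_forall_le fun y hy => (hadm.2.2 y hy).2.trans hlast,
      position_of_onHand_eq_zero hadm h0]
  have hn : r + q + 2 = 1 + (r + q) + 1 := by omega
  rw [hn, stateAfter, stateAfter, key s hs, key s' hs']

end

section

/-! ### Averages along i.i.d. sequences -/

/-- Cesàro convergence along every residue class modulo `K` implies Cesàro convergence. -/
lemma tendsto_average_of_residues {K : ℕ} (hK : 0 < K) {y : ℕ → ℝ} {c : ℝ}
    (h : ∀ i < K, Tendsto (fun n : ℕ => (∑ j ∈ Finset.range n, y (j * K + i)) / n) atTop (𝓝 c)) :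
    Tendsto (fun n : ℕ => (∑ k ∈ Finset.range n, y k) / n) atTop (𝓝 c) := by
  -- number of `k < n` with `k ≡ i` modulo `K`
  set N : ℕ → ℕ → ℕ := fun i n => (n + K - 1 - i) / K with hN
  have hbounds : ∀ i < K, ∀ n, K * N i n ≤ n + K - 1 - i ∧ n + K - 1 - i < K * N i n + K := by
    intro i hi n
    have h1 := Nat.div_add_mod (n + K - 1 - i) K
    have h2 := Nat.mod_lt (n + K - 1 - i) hK
    simp only [hN]
    constructor <;> omega
  have hsum : ∀ n, ∑ k ∈ Finset.range n, y k =
      ∑ i ∈ Finset.range K, ∑ j ∈ Finset.range (N i n), y (j * K + i) := by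
    intro n
    induction n with
    | zero =>
      rw [Finset.sum_range_zero]
      symm
      refine Finset.sum_eq_zero fun i hi => ?_
      have hi' := Finset.mem_range.1 hi
      have : N i 0 = 0 := Nat.div_eq_of_lt (by omega)
      simp [this]
    | succ n ih =>
      have hm : n % K < K := Nat.mod_lt _ hK
      have hdm := Nat.div_add_mod n K
      have e1 : N (n % K) n = n / K := by
        have e : n + K - 1 - n % K = (K - 1) + K * (n / K) := by omega
        simp only [hN]
        rw [e, Nat.add_mul_div_left _ _ hK, Nat.div_eq_of_lt (by omega), zero_add]
      have e2 : N (n % K) (n + 1) = n / K + 1 := by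
        have e : n + 1 + K - 1 - n % K = K * (n / K + 1) := by
          rw [mul_add, mul_one]; omega
        simp only [hN]
        rw [e, Nat.mul_div_cancel_left _ hK]
      have e3 : ∀ i ∈ Finset.range K, i ≠ n % K → N i (n + 1) = N i n := by
        intro i hi hne
        have hi' := Finset.mem_range.1 hi
        simp only [hN]
        have e : n + 1 + K - 1 - i = (n + K - 1 - i) + 1 := by omega
        rw [e, Nat.succ_div, if_neg, add_zero]
        rintro ⟨c, hc⟩
        apply hne
        have : n + K = K * c + i := by omega
        have h2 : (n + K) % K = i := by rw [this, Nat.mul_add_mod, Nat.mod_eq_of_lt hi']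
        rw [← h2, Nat.add_mod_right]
      have hmem : n % K ∈ Finset.range K := Finset.mem_range.2 hm
      rw [Finset.sum_range_succ, ih, ← Finset.add_sum_erase _ _ hmem,
        ← Finset.add_sum_erase _ _ hmem, e1, e2, Finset.sum_range_succ]
      have e4 : n / K * K + n % K = n := by rw [mul_comm]; exact hdm
      have e5 : ∀ i ∈ (Finset.range K).erase (n % K),
          ∑ j ∈ Finset.range (N i (n + 1)), y (j * K + i) =
            ∑ j ∈ Finset.range (N i n), y (j * K + i) := fun i hi => by
        rw [e3 i (Finset.mem_of_mem_erase hi) (Finset.ne_of_mem_erase hi)]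
      rw [e4, Finset.sum_congr rfl e5]
      ring
  have hKpos : (0 : ℝ) < K := by exact_mod_cast hK
  have hdens : ∀ i < K, Tendsto (fun n : ℕ => (N i n : ℝ) / n) atTop (𝓝 (1 / K)) := by
    intro i hi
    rw [tendsto_iff_norm_sub_tendsto_zero]
    refine squeeze_zero' (Eventually.of_forall fun n => norm_nonneg _) ?_
      (tendsto_one_div_atTop_nhds_zero_nat (𝕜 := ℝ))
    filter_upwards [eventually_gt_atTop 0] with n hn
    obtain ⟨h1, h2⟩ := hbounds i hi n
    have h1' : (K : ℝ) * N i n ≤ n + K := by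
      have : K * N i n ≤ n + K := by omega
      exact_mod_cast this
    have h2' : (n : ℝ) ≤ K * N i n + K := by
      have : n ≤ K * N i n + K := by omega
      exact_mod_cast this
    have hn' : (0 : ℝ) < n := by exact_mod_cast hn
    have e : (N i n : ℝ) / n - 1 / K = (K * N i n - n) / (K * n) := by field_simp
    rw [e, Real.norm_eq_abs, abs_div, abs_of_pos (mul_pos hKpos hn'),
      div_le_div_iff₀ (by positivity) hn']
    have : |(K : ℝ) * N i n - n| ≤ K := abs_le.2 ⟨by linarith, by linarith⟩
    nlinarith
  have hNtop : ∀ i < K, Tendsto (N i) atTop atTop := by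
    intro i hi
    refine tendsto_atTop.2 fun b => ?_
    filter_upwards [eventually_ge_atTop (K * b + K)] with n hn
    have h2 := (hbounds i hi n).2
    by_contra hlt
    have : K * N i n + K ≤ K * b := by
      rw [← mul_add_one]; exact Nat.mul_le_mul_left K (by omega)
    omega
  have hterm : ∀ i ∈ Finset.range K, Tendsto
      (fun n : ℕ => (∑ j ∈ Finset.range (N i n), y (j * K + i)) / n) atTop (𝓝 (c * (1 / K))) := by
    intro i hi
    have hi' := Finset.mem_range.1 hi
    refine (((h i hi').comp (hNtop i hi')).mul (hdens i hi')).congr fun n => ?_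
    simp only [Function.comp_apply]
    rcases Nat.eq_zero_or_pos (N i n) with h0 | h0
    · simp [h0]
    · have : (N i n : ℝ) ≠ 0 := by exact_mod_cast h0.ne'
      field_simp
  have := tendsto_finsetSum _ hterm
  rw [Finset.sum_const, Finset.card_range, nsmul_eq_mul,
    show (K : ℝ) * (c * (1 / K)) = c by field_simp] at this
  refine this.congr fun n => ?_
  rw [hsum, Finset.sum_div]

/-- The sequence `a` without its first `n` terms. -/
def shift (n : ℕ) (a : ℕ → ℝ) : ℕ → ℝ := fun i => a (n + i)

lemma measurable_shift (n : ℕ) : Measurable (shift n) := by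
  unfold shift; fun_prop

variable (ν : Measure ℝ) [IsProbabilityMeasure ν]

/-- The law of a sequence of independent random variables with common law `ν`. -/
noncomputable abbrev iidLaw : Measure (ℕ → ℝ) := Measure.infinitePi fun _ : ℕ => ν

lemma measurePreserving_shift (n : ℕ) :
    MeasurePreserving (shift n) (iidLaw ν)
      (iidLaw ν) :=
  ⟨measurable_shift n, Measure.map_infinitePi_infinitePi_of_inj
    (P := fun _ : ℕ => ν) (f := fun i => n + i) (add_right_injective n)⟩

/-- Replacing one term of an i.i.d. sequence by an independent copy does not change its law. -/
lemma measurePreserving_update (m : ℕ) :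
    MeasurePreserving (fun p : (ℕ → ℝ) × ℝ => Function.update p.1 m p.2)
      ((iidLaw ν).prod ν) (iidLaw ν) := by
  have hmeas : Measurable (fun p : (ℕ → ℝ) × ℝ => Function.update p.1 m p.2) := by
    refine measurable_pi_iff.2 fun i => ?_
    by_cases h : i = m
    · subst h; simpa using measurable_snd
    · simp only [Function.update_of_ne h]
      fun_prop
  refine ⟨hmeas, Measure.eq_infinitePi _ fun s t ht => ?_⟩
  rw [Measure.map_apply hmeas (.pi s.countable_toSet fun i _ => ht i)]
  have : (fun p : (ℕ → ℝ) × ℝ => Function.update p.1 m p.2) ⁻¹' (s : Set ℕ).pi t =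
      ((s.erase m : Finset ℕ) : Set ℕ).pi t ×ˢ (if m ∈ s then t m else Set.univ) := by
    ext ⟨a, x⟩
    simp only [Set.mem_preimage, Set.mem_pi, Set.mem_prod, Finset.mem_coe, Finset.mem_erase]
    constructor
    · intro h
      refine ⟨fun i hi => by simpa [Function.update_of_ne hi.1] using h i hi.2, ?_⟩
      split_ifs with hm
      · simpa using h m hm
      · trivial
    · rintro ⟨h1, h2⟩ i hi
      by_cases him : i = m
      · subst him; simpa [hi] using h2
      · simpa [Function.update_of_ne him] using h1 i ⟨him, hi⟩
  rw [this, Measure.prod_prod, Measure.infinitePi_pi _ fun i _ => ht i]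
  split_ifs with hm
  · rw [Finset.prod_erase_mul s (fun i => ν (t i)) hm]
  · rw [measure_univ, mul_one, Finset.erase_eq_of_notMem hm]

/-- Functionals of disjoint stretches of an i.i.d. sequence are independent. -/
lemma indepFun_shift {Φ : (ℕ → ℝ) → ℝ} (hΦ : Measurable Φ) {K : ℕ}
    (hdep : DependsOn Φ (Set.Iio K)) {m n : ℕ} (hmn : m + K ≤ n) :
    IndepFun (fun a => Φ (shift m a)) (fun a => Φ (shift n a))
      (iidLaw ν) := by
  have hind : iIndepFun (fun (i : ℕ) (a : ℕ → ℝ) => a i) (iidLaw ν) :=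
    iIndepFun_infinitePi (P := fun _ : ℕ => ν) (X := fun _ x => x) (fun _ => measurable_id)
  have hdisj : Disjoint (Finset.Ico m (m + K)) (Finset.Ico n (n + K)) := by
    rw [Finset.disjoint_left]
    intro i hi hi'
    simp only [Finset.mem_Ico] at hi hi'
    omega
  have hpair := hind.indepFun_finset _ _ hdisj fun i => measurable_pi_apply i
  let ext : ∀ k : ℕ, (Finset.Ico k (k + K) → ℝ) → ℕ → ℝ := fun k x i =>
    if h : k + i ∈ Finset.Ico k (k + K) then x ⟨k + i, h⟩ else 0
  have hext : ∀ k, Measurable (ext k) := by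
    intro k
    refine measurable_pi_iff.2 fun i => ?_
    simp only [ext]
    split_ifs
    · exact measurable_pi_apply _
    · exact measurable_const
  have hfac : ∀ k, (fun a : ℕ → ℝ => Φ (shift k a)) =
      (Φ ∘ ext k) ∘ (fun a (i : Finset.Ico k (k + K)) => a i) := by
    intro k
    ext a
    refine hdep fun i hi => ?_
    have : k + i ∈ Finset.Ico k (k + K) := by
      simp only [Finset.mem_Ico, Set.mem_Iio] at hi ⊢; omega
    simp only [shift, ext, dif_pos this]
  rw [hfac m, hfac n]
  exact hpair.comp (hΦ.comp (hext m)) (hΦ.comp (hext n))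

/-- Strong law of large numbers for a functional of finitely many consecutive terms of an i.i.d.
sequence. -/
lemma tendsto_average_shift {Φ : (ℕ → ℝ) → ℝ} (hΦ : Measurable Φ)
    (hint : Integrable Φ (iidLaw ν)) {K : ℕ}
    (hdep : DependsOn Φ (Set.Iio K)) :
    ∀ᵐ a ∂(iidLaw ν),
      Tendsto (fun n : ℕ => (∑ k ∈ Finset.range n, Φ (shift k a)) / n) atTop
        (𝓝 (∫ a, Φ a ∂(iidLaw ν))) := by
  have hdep' : DependsOn Φ (Set.Iio (K + 1)) := fun x y h =>
    hdep fun i hi => h i (lt_trans (Set.mem_Iio.1 hi) (Nat.lt_succ_self K))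
  have hident : ∀ n, IdentDistrib (fun a => Φ (shift n a)) Φ
      (iidLaw ν) (iidLaw ν) := fun n =>
    ⟨(hΦ.comp (measurable_shift n)).aemeasurable, hΦ.aemeasurable, by
      rw [← (measurePreserving_shift ν n).map_eq, Measure.map_map hΦ (measurable_shift n),
        (measurePreserving_shift ν n).map_eq]
      rfl⟩
  have hres : ∀ᵐ a ∂(iidLaw ν), ∀ i : ℕ,
      Tendsto (fun n : ℕ => (∑ j ∈ Finset.range n, Φ (shift (j * (K + 1) + i) a)) / n) atTop
        (𝓝 (∫ a, Φ a ∂(iidLaw ν))) := by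
    rw [ae_all_iff]
    intro i
    have := strong_law_ae_real (μ := iidLaw ν)
      (fun j a => Φ (shift (j * (K + 1) + i) a)) ((hident _).integrable_iff.2 hint) ?_
      (fun j => (hident _).trans (hident _).symm)
    · rwa [(hident _).integral_eq] at this
    · intro j l hjl
      rcases lt_or_gt_of_ne hjl with h | h
      · have : (j + 1) * (K + 1) ≤ l * (K + 1) := Nat.mul_le_mul_right _ h
        exact indepFun_shift ν hΦ hdep' (by linarith)
      · have : (l + 1) * (K + 1) ≤ j * (K + 1) := Nat.mul_le_mul_right _ h
        exact (indepFun_shift ν hΦ hdep' (by linarith)).symm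
  filter_upwards [hres] with a ha
  exact tendsto_average_of_residues (y := fun k => Φ (shift k a)) K.succ_pos fun i _ => ha i

end

/-! ### The exponential law -/

section Exponential

variable {lam : ℝ}

lemma expMeasure_Iic (hlam : 0 < lam) (x : ℝ) :
    expMeasure lam (Set.Iic x) =
      ENNReal.ofReal (if 0 ≤ x then 1 - Real.exp (-(lam * x)) else 0) := by
  have := isProbabilityMeasure_expMeasure hlam
  rw [← ofReal_cdf, cdf_expMeasure_eq hlam]

lemma expMeasure_Ioi (hlam : 0 < lam) {x : ℝ} (hx : 0 ≤ x) :
    expMeasure lam (Set.Ioi x) = ENNReal.ofReal (Real.exp (-(lam * x))) := by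
  have := isProbabilityMeasure_expMeasure hlam
  have hle : Real.exp (-(lam * x)) ≤ 1 := Real.exp_le_one_iff.2 (by nlinarith)
  rw [← Set.compl_Iic, prob_compl_eq_one_sub measurableSet_Iic, expMeasure_Iic hlam, if_pos hx,
    ← ENNReal.ofReal_one, ← ENNReal.ofReal_sub _ (by linarith)]
  congr 1; ring

lemma expMeasure_Ici_pos (hlam : 0 < lam) {x : ℝ} (hx : 0 ≤ x) :
    0 < expMeasure lam (Set.Ici x) :=
  lt_of_lt_of_le (by rw [expMeasure_Ioi hlam hx]; exact ENNReal.ofReal_pos.2 (Real.exp_pos _))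
    (measure_mono Set.Ioi_subset_Ici_self)

lemma expMeasure_Ioc_pos (hlam : 0 < lam) {x : ℝ} (hx : 0 < x) :
    0 < expMeasure lam (Set.Ioc 0 x) := by
  have h0 : expMeasure lam (Set.Iic 0) = 0 := by simp [expMeasure_Iic hlam]
  have h1 : expMeasure lam (Set.Iic x) ≤
      expMeasure lam (Set.Iic 0) + expMeasure lam (Set.Ioc 0 x) := by
    rw [← Set.Iic_union_Ioc_eq_Iic hx.le]
    exact measure_union_le _ _
  rw [h0, zero_add] at h1
  refine lt_of_lt_of_le ?_ h1
  rw [expMeasure_Iic hlam, if_pos hx.le, ENNReal.ofReal_pos, sub_pos, Real.exp_lt_one_iff]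
  nlinarith

lemma ae_pos_expMeasure (hlam : 0 < lam) : ∀ᵐ t ∂(expMeasure lam), 0 < t := by
  rw [ae_iff]
  have : {t : ℝ | ¬ 0 < t} = Set.Iic 0 := by ext; simp
  rw [this, expMeasure_Iic hlam]
  simp

lemma lintegral_expMeasure (hlam : 0 < lam) {G : ℝ → ENNReal} (hG : Measurable G) :
    ∫⁻ t, G t ∂(expMeasure lam) =
      ∫⁻ t in Set.Ioi 0, ENNReal.ofReal (lam * Real.exp (-(lam * t))) * G t := by
  have h0 : (expMeasure lam) = volume.withDensity (exponentialPDF lam) := rfl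
  have hm : Measurable (exponentialPDF lam) := (measurable_exponentialPDFReal lam).ennreal_ofReal
  have hres : (expMeasure lam).restrict (Set.Ioi 0) = expMeasure lam :=
    Measure.restrict_eq_self_of_ae_mem (ae_pos_expMeasure hlam)
  nth_rw 1 [← hres]
  rw [h0, setLIntegral_withDensity_eq_setLIntegral_mul _ hm hG
    measurableSet_Ioi]
  refine setLIntegral_congr_fun measurableSet_Ioi fun t ht => ?_
  rw [Pi.mul_apply, exponentialPDF_of_nonneg (le_of_lt ht)]

/-- The reward that accrues at rate `G` during an exponential time is, on average, `1 / lam` times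
the value of `G` at its end. -/
lemma lintegral_lintegral_Ioc_expMeasure (hlam : 0 < lam) {G : ℝ → ENNReal} (hG : Measurable G) :
    ∫⁻ t, (∫⁻ u in Set.Ioc 0 t, G u) ∂(expMeasure lam) =
      ENNReal.ofReal (1 / lam) * ∫⁻ t, G t ∂(expMeasure lam) := by
  have := isProbabilityMeasure_expMeasure hlam
  have hset : MeasurableSet {p : ℝ × ℝ | 0 < p.2 ∧ p.2 ≤ p.1} :=
    (measurableSet_lt measurable_const measurable_snd).inter
      (measurableSet_le measurable_snd measurable_fst)
  have h1 : ∀ t, ∫⁻ u in Set.Ioc 0 t, G u =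
      ∫⁻ u, {p : ℝ × ℝ | 0 < p.2 ∧ p.2 ≤ p.1}.indicator (fun p => G p.2) (t, u) := by
    intro t
    rw [← lintegral_indicator measurableSet_Ioc]
    rfl
  simp_rw [h1]
  have hswap : AEMeasurable (Function.uncurry fun t u : ℝ =>
      {p : ℝ × ℝ | 0 < p.2 ∧ p.2 ≤ p.1}.indicator (fun p => G p.2) (t, u))
      ((expMeasure lam).prod volume) :=
    ((hG.comp measurable_snd).indicator hset).aemeasurable
  rw [lintegral_lintegral_swap hswap]
  have h2 : ∀ u, ∫⁻ t, {p : ℝ × ℝ | 0 < p.2 ∧ p.2 ≤ p.1}.indicator (fun p => G p.2) (t, u)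
      ∂(expMeasure lam) =
      (Set.Ioi 0).indicator (fun u => G u * expMeasure lam (Set.Ici u)) u := by
    intro u
    by_cases hu : 0 < u
    · rw [Set.indicator_of_mem (Set.mem_Ioi.2 hu), ← lintegral_indicator_const measurableSet_Ici]
      refine lintegral_congr fun t => ?_
      by_cases h : u ≤ t <;> simp [Set.indicator, hu, h]
    · rw [Set.indicator_of_notMem (by simpa using hu)]
      simp [Set.indicator, hu]
  simp_rw [h2]
  rw [lintegral_indicator measurableSet_Ioi, lintegral_expMeasure hlam hG,
    ← lintegral_const_mul]
  · refine setLIntegral_congr_fun measurableSet_Ioi fun t ht => ?_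
    have hIci : expMeasure lam (Set.Ici t) = ENNReal.ofReal (Real.exp (-(lam * t))) := by
      rw [← expMeasure_Ioi hlam (le_of_lt ht)]
      refine (measure_congr ?_).symm
      have hac : expMeasure lam ≪ volume := withDensity_absolutelyContinuous _ _
      exact hac.ae_eq Ioi_ae_eq_Ici
    rw [hIci, ← mul_assoc, ← ENNReal.ofReal_mul (by positivity), mul_comm]
    congr 2
    field_simp
  · exact (by fun_prop : Measurable fun t : ℝ =>
      ENNReal.ofReal (lam * Real.exp (-(lam * t)))).mul hG

lemma integrable_abs_expMeasure (hlam : 0 < lam) :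
    Integrable (fun t : ℝ => |t|) (expMeasure lam) := by
  have := isProbabilityMeasure_expMeasure hlam
  refine ⟨by fun_prop, ?_⟩
  have h := lintegral_lintegral_Ioc_expMeasure hlam (G := fun _ => 1) measurable_const
  have h2 : ∫⁻ t : ℝ, ‖|t|‖ₑ ∂(expMeasure lam) =
      ∫⁻ t, (∫⁻ u in Set.Ioc 0 t, (1 : ENNReal)) ∂(expMeasure lam) := by
    refine lintegral_congr_ae ?_
    filter_upwards [ae_pos_expMeasure hlam] with t ht
    simp [abs_of_pos ht, Real.enorm_eq_ofReal ht.le]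
  rw [HasFiniteIntegral, h2, h]
  simp

/-- Bounded form of `lintegral_lintegral_Ioc_expMeasure` for the Bochner integral. -/
lemma integral_integral_Ioc_expMeasure (hlam : 0 < lam) {g : ℝ → ℝ} (hg : Measurable g)
    (h0 : ∀ u, 0 ≤ g u) {C : ℝ} (hC : ∀ u, 0 < u → g u ≤ C) :
    ∫ t, (∫ u in Set.Ioc 0 t, g u) ∂(expMeasure lam) = 1 / lam * ∫ t, g t ∂(expMeasure lam) := by
  have := isProbabilityMeasure_expMeasure hlam
  have hint : ∀ t, IntegrableOn g (Set.Ioc 0 t) := fun t => by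
    refine Measure.integrableOn_of_bounded (M := C) (by simp) hg.aestronglyMeasurable ?_
    filter_upwards [ae_restrict_mem measurableSet_Ioc] with u hu
    rw [Real.norm_of_nonneg (h0 u)]
    exact hC u hu.1
  have hin : ∀ t, ENNReal.ofReal (∫ u in Set.Ioc 0 t, g u) =
      ∫⁻ u in Set.Ioc 0 t, ENNReal.ofReal (g u) := fun t =>
    ofReal_integral_eq_lintegral_ofReal (hint t) (Eventually.of_forall h0)
  have hin' : ∀ t, (∫ u in Set.Ioc 0 t, g u) =
      (∫⁻ u in Set.Ioc 0 t, ENNReal.ofReal (g u)).toReal := fun t => by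
    rw [← hin, ENNReal.toReal_ofReal (integral_nonneg h0)]
  have hmeas : Measurable fun t => ∫⁻ u in Set.Ioc 0 t, ENNReal.ofReal (g u) := by
    have : Monotone fun t => ∫⁻ u in Set.Ioc 0 t, ENNReal.ofReal (g u) := fun s t hst =>
      lintegral_mono_set (Set.Ioc_subset_Ioc_right hst)
    exact this.measurable
  rw [integral_eq_lintegral_of_nonneg_ae (Eventually.of_forall fun t => integral_nonneg h0),
    integral_eq_lintegral_of_nonneg_ae (Eventually.of_forall h0) hg.aestronglyMeasurable]
  · simp_rw [hin]
    rw [lintegral_lintegral_Ioc_expMeasure hlam hg.ennreal_ofReal, ENNReal.toReal_mul,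
      ENNReal.toReal_ofReal (by positivity)]
  · refine (Measurable.aestronglyMeasurable ?_)
    simp_rw [hin']
    exact hmeas.ennreal_toReal

end Exponential

/-! ### Measurability of state-valued functions -/

/-- Measurability of a state-valued function, without putting a `σ`-algebra on `State`: the stock
on hand is measurable, and so is every sum of a measurable function over the remaining lead times
of the outstanding orders. -/
structure MeasurableState {α : Type} [MeasurableSpace α] (S : α → State) : Prop where
  onHand : Measurable fun ω => (S ω).onHand
  sum : ∀ g : α × ℝ → ℝ, Measurable g →
    Measurable fun ω => ((S ω).outstanding.map fun y => g (ω, y)).sum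

section Measurability

variable {α : Type} [MeasurableSpace α] {S : α → State} {q r : ℕ} {τ : ℝ}

lemma sum_map_ite_one {β : Type*} (l : List β) (p : β → Prop) [DecidablePred p] :
    (l.map fun y => if p y then (1 : ℝ) else 0).sum = (l.countP fun y => decide (p y) : ℕ) := by
  induction l with
  | nil => simp
  | cons y l ih =>
    by_cases h : p y <;> simp [h, ih, add_comm]

lemma measurable_natCast_real {f : α → ℕ} (hf : Measurable fun ω => (f ω : ℝ)) :
    Measurable f := by
  have := Nat.measurable_floor.comp hf
  simpa [Function.comp_def] using this

lemma measurableState_const (s : State) : MeasurableState (fun _ : α => s) := by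
  refine ⟨measurable_const, fun g hg => ?_⟩
  induction s.outstanding with
  | nil => simp
  | cons y l ih =>
    simp only [List.map_cons, List.sum_cons]
    exact (hg.comp (measurable_id.prodMk measurable_const)).add ih

lemma MeasurableState.countP_le (hS : MeasurableState S) {t : α → ℝ} (ht : Measurable t) :
    Measurable fun ω => (S ω).outstanding.countP fun y => decide (y ≤ t ω) := by
  refine measurable_natCast_real ?_
  simp_rw [← sum_map_ite_one]
  exact hS.sum (fun p => if p.2 ≤ t p.1 then 1 else 0)
    (Measurable.ite (measurableSet_le measurable_snd (ht.comp measurable_fst))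
      measurable_const measurable_const)

lemma MeasurableState.length (hS : MeasurableState S) :
    Measurable fun ω => (S ω).outstanding.length := by
  refine measurable_natCast_real ?_
  have := hS.sum (fun _ => 1) measurable_const
  simpa using this

lemma MeasurableState.position (hS : MeasurableState S) :
    Measurable fun ω => (S ω).position q :=
  hS.onHand.add (hS.length.const_mul q)

lemma MeasurableState.elapse (hS : MeasurableState S) {t : α → ℝ} (ht : Measurable t) :
    MeasurableState fun ω => (S ω).elapse q (t ω) := by
  refine ⟨hS.onHand.add ((hS.countP_le ht).const_mul q), fun g hg => ?_⟩
  have hsum : ∀ (l : List ℝ) (ω : α),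
      (((l.filter fun y => decide (t ω < y)).map fun y => y - t ω).map fun y => g (ω, y)).sum =
        (l.map fun y => if t ω < y then g (ω, y - t ω) else 0).sum := by
    intro l ω
    induction l with
    | nil => simp
    | cons y l ih =>
      by_cases h : t ω < y
      · simp only [List.filter_cons, h, decide_true, if_true, List.map_cons, List.sum_cons, ih]
      · simp only [List.filter_cons, h, decide_false, Bool.false_eq_true, if_false, ih,
          List.map_cons, List.sum_cons, zero_add]
  simp only [State.elapse]
  simp_rw [hsum]
  refine hS.sum (fun p => if t p.1 < p.2 then g (p.1, p.2 - t p.1) else 0)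
    (Measurable.ite (measurableSet_lt (ht.comp measurable_fst) measurable_snd) ?_
      measurable_const)
  exact hg.comp (measurable_fst.prodMk (measurable_snd.sub (ht.comp measurable_fst)))

lemma MeasurableState.demand (hS : MeasurableState S) :
    MeasurableState fun ω => (S ω).demand r q τ := by
  have h0 : MeasurableSet {ω | (S ω).onHand = 0} := hS.onHand (measurableSet_singleton 0)
  have h1 : MeasurableSet {ω | (S ω).position q - 1 ≤ r} :=
    hS.position (MeasurableSet.of_discrete (s := {n : ℕ | n - 1 ≤ r}))
  refine ⟨?_, fun g hg => ?_⟩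
  · simp_rw [onHand_demand]
    exact (measurable_of_countable fun n : ℕ => n - 1).comp hS.onHand
  · have : (fun ω => (((S ω).demand r q τ).outstanding.map fun y => g (ω, y)).sum) = fun ω =>
        if (S ω).onHand = 0 then ((S ω).outstanding.map fun y => g (ω, y)).sum
        else if (S ω).position q - 1 ≤ r then
          ((S ω).outstanding.map fun y => g (ω, y)).sum + g (ω, τ)
        else ((S ω).outstanding.map fun y => g (ω, y)).sum := by
      ext ω
      unfold State.demand
      split_ifs <;> simp
    rw [this]
    exact Measurable.ite h0 (hS.sum g hg) (Measurable.ite h1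
      ((hS.sum g hg).add (hg.comp (measurable_id.prodMk measurable_const))) (hS.sum g hg))

lemma measurableState_stateAfter (s₀ : State) {A : α → ℕ → ℝ} (hA : Measurable A) (n : ℕ) :
    MeasurableState fun ω => stateAfter r q τ s₀ (A ω) n := by
  induction n with
  | zero => exact measurableState_const s₀
  | succ n ih => exact (ih.elapse (measurable_pi_iff.1 hA n)).demand

/-- A function of the state is observable if it is measurable along all measurable state-valued
functions. -/
def Observable (h : State → ℝ) : Prop :=
  ∀ {α : Type} [MeasurableSpace α] (S : α → State), MeasurableState S → Measurable fun ω => h (S ω)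

lemma Observable.measurable_elapse {h : State → ℝ} (hh : Observable h) (s : State) :
    Measurable fun u => h (s.elapse q u) :=
  hh _ ((measurableState_const s).elapse measurable_id)

end Measurability

section

/-! ### Long-run averages over customers -/

lemma tendsto_average_of_shift {u : ℕ → ℝ} {c : ℝ} (M : ℕ)
    (h : Tendsto (fun n : ℕ => (∑ k ∈ Finset.range n, u (k + M)) / n) atTop (𝓝 c)) :
    Tendsto (fun n : ℕ => (∑ k ∈ Finset.range n, u k) / n) atTop (𝓝 c) := by
  rw [← tendsto_add_atTop_iff_nat M]
  have h1 : Tendsto (fun n : ℕ => (∑ k ∈ Finset.range M, u k) / ((n + M : ℕ) : ℝ)) atTop (𝓝 0) :=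
    ((tendsto_const_div_atTop_nhds_zero_nat _).comp (tendsto_add_atTop_nat M))
  have h2 : Tendsto (fun n : ℕ => (n : ℝ) / ((n : ℝ) + M)) atTop (𝓝 1) :=
    tendsto_natCast_div_add_atTop (M : ℝ)
  have h3 := h1.add (h.mul h2)
  rw [mul_one, zero_add] at h3
  refine h3.congr' ?_
  filter_upwards [eventually_gt_atTop 0] with n hn
  have hn' : (n : ℝ) ≠ 0 := by exact_mod_cast hn.ne'
  have hn2 : (n : ℝ) + M ≠ 0 := by positivity
  have hs : ∑ k ∈ Finset.range (n + M), u k =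
      ∑ k ∈ Finset.range M, u k + ∑ k ∈ Finset.range n, u (k + M) := by
    rw [add_comm n M, Finset.sum_range_add]
    simp_rw [add_comm M]
  rw [hs]
  push_cast
  field_simp

/-- A sequence whose shifts are approximated, up to an error with small Cesàro mean, by sequences
with a Cesàro mean, has itself a Cesàro mean. -/
lemma exists_average_of_approx {x : ℕ → ℝ} {y d : ℕ → ℕ → ℝ} {c e : ℕ → ℝ}
    (hxy : ∀ M k, |x (k + M) - y M k| ≤ d M k)
    (hy : ∀ M, Tendsto (fun n : ℕ => (∑ k ∈ Finset.range n, y M k) / n) atTop (𝓝 (c M)))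
    (hd : ∀ M, Tendsto (fun n : ℕ => (∑ k ∈ Finset.range n, d M k) / n) atTop (𝓝 (e M)))
    (he : Tendsto e atTop (𝓝 0)) :
    ∃ l, Tendsto c atTop (𝓝 l) ∧
      Tendsto (fun n : ℕ => (∑ k ∈ Finset.range n, x k) / n) atTop (𝓝 l) := by
  set A : ℕ → ℝ := fun n => (∑ k ∈ Finset.range n, x k) / n with hA
  have key : ∀ M, ∀ ε > 0, ∀ᶠ n in atTop, |A n - c M| < e M + ε := by
    intro M ε hε
    set y' : ℕ → ℝ := fun k => if k < M then x k else y M (k - M) with hy'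
    set d' : ℕ → ℝ := fun k => if k < M then 0 else d M (k - M) with hd'
    have h1 : Tendsto (fun n : ℕ => (∑ k ∈ Finset.range n, y' k) / n) atTop (𝓝 (c M)) :=
      tendsto_average_of_shift M (by simpa [hy'] using hy M)
    have h2 : Tendsto (fun n : ℕ => (∑ k ∈ Finset.range n, d' k) / n) atTop (𝓝 (e M)) :=
      tendsto_average_of_shift M (by simpa [hd'] using hd M)
    have h3 : ∀ k, |x k - y' k| ≤ d' k := by
      intro k
      by_cases hk : k < M
      · simp [hy', hd', hk]
      · have := hxy M (k - M)
        rw [Nat.sub_add_cancel (not_lt.1 hk)] at this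
        simpa [hy', hd', hk] using this
    have h4 : ∀ n : ℕ, |A n - (∑ k ∈ Finset.range n, y' k) / n| ≤
        (∑ k ∈ Finset.range n, d' k) / n := by
      intro n
      rw [hA]
      dsimp only
      rw [← sub_div, ← Finset.sum_sub_distrib, abs_div, Nat.abs_cast]
      gcongr
      exact (Finset.abs_sum_le_sum_abs _ _).trans (Finset.sum_le_sum fun k _ => h3 k)
    filter_upwards [(Metric.tendsto_nhds.1 h1) (ε / 2) (by positivity),
      (Metric.tendsto_nhds.1 h2) (ε / 2) (by positivity)] with n hn1 hn2
    rw [Real.dist_eq] at hn1 hn2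
    have := h4 n
    rw [abs_lt] at *
    rw [abs_le] at this
    constructor <;> linarith [this.1, this.2, hn1.1, hn1.2, hn2.1, hn2.2]
  have hcauchy : CauchySeq A := by
    rw [Metric.cauchySeq_iff']
    intro ε hε
    obtain ⟨M, hM⟩ := (he.eventually (gt_mem_nhds (show (0 : ℝ) < ε / 4 by positivity))).exists
    obtain ⟨N, hN⟩ := eventually_atTop.1 (key M (ε / 4) (by positivity))
    refine ⟨N, fun n hn => ?_⟩
    have h1 := hN n hn
    have h2 := hN N le_rfl
    rw [Real.dist_eq]
    rw [abs_lt] at *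
    constructor <;> linarith [h1.1, h1.2, h2.1, h2.2]
  obtain ⟨l, hl⟩ := cauchySeq_tendsto_of_complete hcauchy
  refine ⟨l, ?_, hl⟩
  rw [tendsto_iff_norm_sub_tendsto_zero]
  refine squeeze_zero (fun _ => norm_nonneg _) (fun M => ?_) he
  rw [Real.norm_eq_abs, abs_sub_comm]
  refine le_of_forall_pos_le_add fun ε hε => ?_
  exact le_of_tendsto (hl.sub_const (c M)).abs ((key M ε hε).mono fun n hn => hn.le)

variable {r q : ℕ} {τ : ℝ}

/-- None of the stretches of the first `M` interarrival times is a clearing pattern. -/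
def NoClearing (r q : ℕ) (τ : ℝ) (M : ℕ) (a : ℕ → ℝ) : Prop :=
  ∀ k, k + (r + q + 2) ≤ M → ¬ Clearing r q τ (shift k a)

lemma stateAfter_eq_of_not_noClearing (hq : 0 < q) (hτ : 0 < τ) {s s' : State}
    (hs : s.Admissible r q τ) (hs' : s'.Admissible r q τ) {a : ℕ → ℝ} (ha : ∀ n, 0 < a n)
    {M : ℕ} (h : ¬ NoClearing r q τ M a) :
    stateAfter r q τ s a M = stateAfter r q τ s' a M := by
  simp only [NoClearing, not_forall, not_not] at h
  obtain ⟨k, hk, hc⟩ := h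
  obtain ⟨j, rfl⟩ := Nat.exists_eq_add_of_le hk
  rw [stateAfter_add s, stateAfter_add s', stateAfter_add s, stateAfter_add s']
  congr 1
  exact stateAfter_eq_of_clearing hq hτ (admissible_stateAfter hq hτ hs ha k)
    (admissible_stateAfter hq hτ hs' ha k) hc

lemma measurableSet_clearing : MeasurableSet {a : ℕ → ℝ | Clearing r q τ a} := by
  have : {a : ℕ → ℝ | Clearing r q τ a} =
      (Finset.range (r + q + 2) : Set ℕ).pi (clearingSet r q τ) := by
    ext a
    simp [Clearing, Set.mem_pi]
  rw [this]
  refine .pi (Finset.countable_toSet _) fun i _ => ?_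
  unfold clearingSet
  split_ifs
  · exact measurableSet_Ioc
  · exact measurableSet_Ici

lemma measurableSet_noClearing (M : ℕ) : MeasurableSet {a : ℕ → ℝ | NoClearing r q τ M a} := by
  simp only [NoClearing, Set.ofPred_forall]
  exact .iInter fun k => .iInter fun _ => (measurable_shift k measurableSet_clearing).compl

lemma clearing_congr {a b : ℕ → ℝ} (h : ∀ i < r + q + 2, a i = b i) :
    Clearing r q τ a ↔ Clearing r q τ b := by
  unfold Clearing
  exact forall₂_congr fun i hi => by rw [h i (Finset.mem_range.1 hi)]

lemma noClearing_congr {M : ℕ} {a b : ℕ → ℝ} (h : ∀ i < M, a i = b i) :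
    NoClearing r q τ M a ↔ NoClearing r q τ M b := by
  unfold NoClearing
  refine forall₂_congr fun k hk => not_congr (clearing_congr fun i hi => ?_)
  exact h (k + i) (by omega)

section Ergodic

variable {ν : Measure ℝ} [IsProbabilityMeasure ν]

lemma ae_forall_pos (hν0 : ∀ᵐ t ∂ν, 0 < t) : ∀ᵐ a ∂(iidLaw ν), ∀ n, 0 < a n := by
  rw [ae_all_iff]
  intro n
  have := (measurePreserving_eval_infinitePi (fun _ : ℕ => ν) n).quasiMeasurePreserving.ae hν0
  simpa using this

lemma ae_exists_clearing (hclear : ∀ i, 0 < ν (clearingSet r q τ i)) :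
    ∀ᵐ a ∂(iidLaw ν), ∃ k, Clearing r q τ (shift k a) := by
  classical
  have hpos : 0 < (iidLaw ν).real {a | Clearing r q τ a} := by
    have : {a : ℕ → ℝ | Clearing r q τ a} =
        (Finset.range (r + q + 2) : Set ℕ).pi (clearingSet r q τ) := by
      ext a
      simp [Clearing, Set.mem_pi]
    rw [measureReal_def, ENNReal.toReal_pos_iff]
    refine ⟨?_, measure_lt_top _ _⟩
    rw [this, iidLaw, Measure.infinitePi_pi]
    · exact CanonicallyOrderedAdd.prod_pos.2 fun i _ => hclear i
    · intro i _
      unfold clearingSet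
      split_ifs
      · exact measurableSet_Ioc
      · exact measurableSet_Ici
  have hdep : DependsOn ({a : ℕ → ℝ | Clearing r q τ a}.indicator fun _ => (1 : ℝ))
      (Set.Iio (r + q + 2)) := by
    intro a b hab
    have := clearing_congr (r := r) (q := q) (τ := τ) (a := a) (b := b) fun i hi => hab i hi
    simp only [Set.indicator, Set.mem_ofPred_eq, this]
  have := tendsto_average_shift ν (measurable_const.indicator measurableSet_clearing)
    ((integrable_const (1 : ℝ)).indicator measurableSet_clearing) hdep
  filter_upwards [this] with a ha
  by_contra hno
  push Not at hno
  have h0 : ∀ k, {a : ℕ → ℝ | Clearing r q τ a}.indicator (fun _ => (1 : ℝ)) (shift k a) = 0 :=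
    fun k => Set.indicator_of_notMem (hno k) _
  simp only [h0, Finset.sum_const_zero, zero_div] at ha
  have := tendsto_nhds_unique ha tendsto_const_nhds
  rw [integral_indicator_const _ measurableSet_clearing, smul_eq_mul, mul_one] at this
  exact hpos.ne' this

lemma tendsto_integral_noClearing (hclear : ∀ i, 0 < ν (clearingSet r q τ i)) :
    Tendsto (fun M => ∫ a, {a : ℕ → ℝ | NoClearing r q τ M a}.indicator (fun _ => (1 : ℝ)) a
      ∂(iidLaw ν)) atTop (𝓝 0) := by
  have h := tendsto_integral_of_dominated_convergence (μ := iidLaw ν)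
    (F := fun M => {a : ℕ → ℝ | NoClearing r q τ M a}.indicator (fun _ => (1 : ℝ)))
    (f := fun _ => 0) (fun _ => 1)
    (fun M => (measurable_const.indicator (measurableSet_noClearing M)).aestronglyMeasurable)
    (integrable_const 1)
    (fun M => Eventually.of_forall fun a => by
      refine (norm_indicator_le_norm_self _ _).trans ?_
      simp)
    (by
      filter_upwards [ae_exists_clearing hclear] with a ⟨k, hk⟩
      refine tendsto_const_nhds.congr' ?_
      filter_upwards [eventually_ge_atTop (k + (r + q + 2))] with M hM
      exact (Set.indicator_of_notMem (s := {a : ℕ → ℝ | NoClearing r q τ M a})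
        (fun hn : NoClearing r q τ M a => hn k hM hk) _).symm)
  simpa using h

/-- Ergodicity: a reward `F s t` for each interarrival time `t` that starts in state `s` has the
same long-run average over the customers from all initial states. The average is the limit of the
expected rewards in the system that starts with full stock. -/
theorem exists_customer_average (hq : 0 < q) (hτ : 0 < τ) (hν0 : ∀ᵐ t ∂ν, 0 < t)
    (hν1 : Integrable (fun t : ℝ => |t|) ν) (hclear : ∀ i, 0 < ν (clearingSet r q τ i))
    {F : State → ℝ → ℝ}
    (hFm : ∀ n, Measurable fun a : ℕ → ℝ => F (stateAfter r q τ ⟨r + q, []⟩ a n) (a n))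
    {C : ℝ} (hFb : ∀ s : State, s.Admissible r q τ → ∀ t, 0 < t → |F s t| ≤ C * (1 + |t|)) :
    ∃ c, Tendsto (fun n => ∫ a, F (stateAfter r q τ ⟨r + q, []⟩ a n) (a n) ∂(iidLaw ν))
        atTop (𝓝 c) ∧
      ∀ᵐ a ∂(iidLaw ν), ∀ s₀ : State, s₀.Admissible r q τ →
        Tendsto (fun n : ℕ => (∑ k ∈ Finset.range n, F (stateAfter r q τ s₀ a k) (a k)) / n)
          atTop (𝓝 c) := by
  classical
  have hfull : (State.mk (r + q) []).Admissible r q τ := admissible_full hq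
  set Φ : ℕ → (ℕ → ℝ) → ℝ := fun M a => F (stateAfter r q τ ⟨r + q, []⟩ a M) (a M) with hΦ
  set Ψ : ℕ → (ℕ → ℝ) → ℝ := fun M a =>
    {a : ℕ → ℝ | NoClearing r q τ M a}.indicator (fun _ => (1 : ℝ)) a *
      (2 * (C * (1 + |a M|))) with hΨ
  have hbint : ∀ M, Integrable (fun a : ℕ → ℝ => C * (1 + |a M|)) (iidLaw ν) := fun M =>
    ((integrable_const 1).add ((measurePreserving_eval_infinitePi (fun _ : ℕ => ν)
      M).integrable_comp_of_integrable hν1)).const_mul C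
  have hΨm : ∀ M, Measurable (Ψ M) := fun M =>
    (measurable_const.indicator (measurableSet_noClearing M)).mul (by fun_prop)
  have hΦint : ∀ M, Integrable (Φ M) (iidLaw ν) := fun M => by
    refine (hbint M).mono' (hFm M).aestronglyMeasurable ?_
    filter_upwards [ae_forall_pos hν0] with a ha
    exact hFb _ (admissible_stateAfter hq hτ hfull ha M) _ (ha M)
  have hΨint : ∀ M, Integrable (Ψ M) (iidLaw ν) := fun M => by
    refine ((hbint M).const_mul 2).abs.mono' (hΨm M).aestronglyMeasurable ?_
    refine Eventually.of_forall fun a => ?_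
    rw [hΨ, norm_mul, Real.norm_eq_abs (2 * _)]
    refine mul_le_of_le_one_left (abs_nonneg _) ?_
    refine (norm_indicator_le_norm_self _ _).trans ?_
    simp
  have hΦdep : ∀ M, DependsOn (Φ M) (Set.Iio (M + 1)) := fun M a b hab => by
    have h1 : a M = b M := hab M (Set.mem_Iio.2 (Nat.lt_succ_self M))
    have h2 := stateAfter_congr (r := r) (q := q) (τ := τ) ⟨r + q, []⟩ (a := a) (b := b) (n := M)
      fun i hi => hab i (Set.mem_Iio.2 (by omega))
    simp only [hΦ, h1, h2]
  have hΨdep : ∀ M, DependsOn (Ψ M) (Set.Iio (M + 1)) := fun M a b hab => by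
    have h1 : a M = b M := hab M (Set.mem_Iio.2 (Nat.lt_succ_self M))
    have h2 := noClearing_congr (r := r) (q := q) (τ := τ) (a := a) (b := b) (M := M)
      fun i hi => hab i (Set.mem_Iio.2 (by omega))
    simp only [hΨ, h1, Set.indicator, Set.mem_ofPred_eq, h2]
  -- whether the first `M` terms clear the system is independent of the term with index `M`
  have hΨlim : Tendsto (fun M => ∫ a, Ψ M a ∂(iidLaw ν)) atTop (𝓝 0) := by
    have h1 : ∀ M, ∫ a, Ψ M a ∂(iidLaw ν) =
        (∫ a, {a : ℕ → ℝ | NoClearing r q τ M a}.indicator (fun _ => (1 : ℝ)) a ∂(iidLaw ν)) *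
          ∫ t, 2 * (C * (1 + |t|)) ∂ν := by
      intro M
      have hprod := integral_prod_mul (μ := iidLaw ν) (ν := ν)
        ({a : ℕ → ℝ | NoClearing r q τ M a}.indicator fun _ => (1 : ℝ))
        (fun t => 2 * (C * (1 + |t|)))
      rw [← hprod]
      nth_rw 1 [← (measurePreserving_update ν M).map_eq]
      rw [integral_map (measurePreserving_update ν M).measurable.aemeasurable
          (hΨm M).aestronglyMeasurable]
      refine integral_congr_ae (Eventually.of_forall fun p => ?_)
      have h2 := noClearing_congr (r := r) (q := q) (τ := τ) (a := Function.update p.1 M p.2)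
        (b := p.1) (M := M) fun i hi => Function.update_of_ne hi.ne _ _
      simp only [hΨ, Function.update_self, Set.indicator, Set.mem_ofPred_eq, h2]
    simp_rw [h1]
    simpa using (tendsto_integral_noClearing hclear).mul_const _
  have hav : ∀ᵐ a ∂(iidLaw ν), (∀ n, 0 < a n) ∧
      (∀ M, Tendsto (fun n : ℕ => (∑ k ∈ Finset.range n, Φ M (shift k a)) / n) atTop
        (𝓝 (∫ a, Φ M a ∂(iidLaw ν)))) ∧
      (∀ M, Tendsto (fun n : ℕ => (∑ k ∈ Finset.range n, Ψ M (shift k a)) / n) atTop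
        (𝓝 (∫ a, Ψ M a ∂(iidLaw ν)))) := by
    have h1 := ae_all_iff.2 fun M => tendsto_average_shift ν (hFm M) (hΦint M) (hΦdep M)
    have h2 := ae_all_iff.2 fun M => tendsto_average_shift ν (hΨm M) (hΨint M) (hΨdep M)
    filter_upwards [ae_forall_pos hν0, h1, h2] with a ha0 ha1 ha2
    exact ⟨ha0, ha1, ha2⟩
  have hpath : ∀ a : ℕ → ℝ, (∀ n, 0 < a n) → ∀ s₀ : State, s₀.Admissible r q τ → ∀ M k,
      |F (stateAfter r q τ s₀ a (k + M)) (a (k + M)) - Φ M (shift k a)| ≤ Ψ M (shift k a) := by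
    intro a ha s₀ hs₀ M k
    have hak : ∀ n, 0 < shift k a n := fun n => ha _
    have hs := admissible_stateAfter hq hτ hs₀ ha k
    have e : stateAfter r q τ s₀ a (k + M) =
        stateAfter r q τ (stateAfter r q τ s₀ a k) (shift k a) M := stateAfter_add _ _ _ _
    rw [e]
    change |F _ (shift k a M) - F _ (shift k a M)| ≤ _
    by_cases hc : NoClearing r q τ M (shift k a)
    · simp only [hΨ]
      rw [Set.indicator_of_mem (by exact hc), one_mul]
      have h1 := hFb _ (admissible_stateAfter hq hτ hs hak M) _ (hak M)
      have h2 := hFb _ (admissible_stateAfter hq hτ hfull hak M) _ (hak M)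
      refine (abs_sub _ _).trans ?_
      linarith
    · rw [stateAfter_eq_of_not_noClearing hq hτ hs hfull hak hc, sub_self, abs_zero]
      simp only [hΨ]
      rw [Set.indicator_of_notMem (by exact hc), zero_mul]
  have hlim : ∀ a : ℕ → ℝ, ((∀ n, 0 < a n) ∧
      (∀ M, Tendsto (fun n : ℕ => (∑ k ∈ Finset.range n, Φ M (shift k a)) / n) atTop
        (𝓝 (∫ a, Φ M a ∂(iidLaw ν)))) ∧
      (∀ M, Tendsto (fun n : ℕ => (∑ k ∈ Finset.range n, Ψ M (shift k a)) / n) atTop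
        (𝓝 (∫ a, Ψ M a ∂(iidLaw ν))))) → ∀ s₀ : State, s₀.Admissible r q τ →
      ∃ l, Tendsto (fun M => ∫ a, Φ M a ∂(iidLaw ν)) atTop (𝓝 l) ∧
        Tendsto (fun n : ℕ => (∑ k ∈ Finset.range n, F (stateAfter r q τ s₀ a k) (a k)) / n)
          atTop (𝓝 l) := fun a ha s₀ hs₀ =>
    exists_average_of_approx (x := fun k => F (stateAfter r q τ s₀ a k) (a k))
      (hpath a ha.1 s₀ hs₀) ha.2.1 ha.2.2 hΨlim
  obtain ⟨a, ha⟩ := hav.exists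
  obtain ⟨c, hc, -⟩ := hlim a ha _ hfull
  refine ⟨c, hc, ?_⟩
  filter_upwards [hav] with a ha s₀ hs₀
  obtain ⟨l, hl, hl'⟩ := hlim a ha s₀ hs₀
  rwa [tendsto_nhds_unique hc hl]

end Ergodic

end

/-! ### Poisson arrivals see time averages -/

section Poisson

variable {r q : ℕ} {τ lam : ℝ} {h : State → ℝ} {C : ℝ}

lemma expMeasure_clearingSet_pos (hlam : 0 < lam) (hτ : 0 < τ) (i : ℕ) :
    0 < expMeasure lam (clearingSet r q τ i) := by
  unfold clearingSet
  split_ifs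
  · exact expMeasure_Ioc_pos hlam (by positivity)
  · exact expMeasure_Ici_pos hlam hτ.le

lemma Observable.measurable_accrued (hh : Observable h) (n : ℕ) :
    Measurable fun a : ℕ → ℝ =>
      ∫ u in Set.Ioc 0 (a n), h ((stateAfter r q τ ⟨r + q, []⟩ a n).elapse q u) := by
  have hset : MeasurableSet {p : (ℕ → ℝ) × ℝ | 0 < p.2 ∧ p.2 ≤ p.1 n} :=
    (measurableSet_lt measurable_const measurable_snd).inter
      (measurableSet_le measurable_snd (by fun_prop))
  have hm : Measurable ({p : (ℕ → ℝ) × ℝ | 0 < p.2 ∧ p.2 ≤ p.1 n}.indicator fun p =>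
      h ((stateAfter r q τ ⟨r + q, []⟩ p.1 n).elapse q p.2)) :=
    (hh _ ((measurableState_stateAfter _ measurable_fst n).elapse measurable_snd)).indicator hset
  have := hm.stronglyMeasurable.integral_prod_right' (ν := volume)
  convert this.measurable using 2 with a
  rw [← integral_indicator measurableSet_Ioc]
  rfl

/-- For a bounded observable, the average over the states that the customers find and the average
over time exist and are the same, up to the mean interarrival time `1 / lam`. -/
theorem exists_average_of_observable (hq : 0 < q) (hτ : 0 < τ) (hlam : 0 < lam)
    (hh : Observable h) (h0 : ∀ s, 0 ≤ h s)
    (hC : ∀ s : State, s.Admissible r q τ → h s ≤ C) :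
    ∃ c, ∀ᵐ a ∂(iidLaw (expMeasure lam)), ∀ s₀ : State, s₀.Admissible r q τ →
      Tendsto (fun n : ℕ => (∑ k ∈ Finset.range n, h (stateBefore r q τ s₀ a k)) / n)
        atTop (𝓝 c) ∧
      Tendsto (fun n : ℕ => (∑ k ∈ Finset.range n,
        ∫ u in Set.Ioc 0 (a k), h ((stateAfter r q τ s₀ a k).elapse q u)) / n)
        atTop (𝓝 (1 / lam * c)) := by
  have := isProbabilityMeasure_expMeasure hlam
  have hfull : (State.mk (r + q) []).Admissible r q τ := admissible_full hq
  have hC0 : 0 ≤ C := (h0 _).trans (hC _ hfull)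
  have hν0 := ae_pos_expMeasure hlam
  have hν1 := integrable_abs_expMeasure hlam
  have hbefore : ∀ n, Measurable fun a : ℕ → ℝ =>
      h ((stateAfter r q τ ⟨r + q, []⟩ a n).elapse q (a n)) := fun n =>
    hh _ ((measurableState_stateAfter _ measurable_id n).elapse (measurable_pi_apply n))
  have hbound₁ : ∀ s : State, s.Admissible r q τ → ∀ t, 0 < t →
      |h (s.elapse q t)| ≤ C * (1 + |t|) := by
    intro s hs t ht
    rw [abs_of_nonneg (h0 _)]
    exact (hC _ (hs.elapse ht.le)).trans (by nlinarith [abs_nonneg t])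
  have hbound₂ : ∀ s : State, s.Admissible r q τ → ∀ t, 0 < t →
      |∫ u in Set.Ioc 0 t, h (s.elapse q u)| ≤ C * (1 + |t|) := by
    intro s hs t ht
    have h1 := norm_setIntegral_le_of_norm_le_const (μ := volume) (s := Set.Ioc 0 t)
      (f := fun u => h (s.elapse q u)) (C := C) (by simp) fun u hu => by
        rw [Real.norm_of_nonneg (h0 _)]
        exact hC _ (hs.elapse hu.1.le)
    rw [← Real.norm_eq_abs]
    refine h1.trans ?_
    rw [measureReal_def, Real.volume_Ioc, ENNReal.toReal_ofReal (by linarith), abs_of_pos ht]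
    nlinarith
  obtain ⟨c, hc, hac⟩ := exists_customer_average (F := fun s t => h (s.elapse q t))
    hq hτ hν0 hν1 (expMeasure_clearingSet_pos hlam hτ) hbefore hbound₁
  obtain ⟨c', hc', hac'⟩ := exists_customer_average
    (F := fun s t => ∫ u in Set.Ioc 0 t, h (s.elapse q u))
    hq hτ hν0 hν1 (expMeasure_clearingSet_pos hlam hτ) (fun n => hh.measurable_accrued n) hbound₂
  -- the state at the start of an interarrival time is independent of its length
  have hsplit : ∀ {F : State → ℝ → ℝ} (n : ℕ),
      (Measurable fun a : ℕ → ℝ => F (stateAfter r q τ ⟨r + q, []⟩ a n) (a n)) →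
      (∀ s : State, s.Admissible r q τ → ∀ t, 0 < t → |F s t| ≤ C * (1 + |t|)) →
      ∫ a, F (stateAfter r q τ ⟨r + q, []⟩ a n) (a n) ∂(iidLaw (expMeasure lam)) =
        ∫ a, (∫ t, F (stateAfter r q τ ⟨r + q, []⟩ a n) t ∂(expMeasure lam))
          ∂(iidLaw (expMeasure lam)) := by
    intro F n hm hb
    have hmp := measurePreserving_update (expMeasure lam) n
    have hint : Integrable (fun a : ℕ → ℝ => F (stateAfter r q τ ⟨r + q, []⟩ a n) (a n))
        (iidLaw (expMeasure lam)) := by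
      refine Integrable.mono' (g := fun a : ℕ → ℝ => C * (1 + |a n|))
        (((integrable_const 1).add ((measurePreserving_eval_infinitePi
          (fun _ : ℕ => expMeasure lam) n).integrable_comp_of_integrable hν1)).const_mul C)
        hm.aestronglyMeasurable ?_
      filter_upwards [ae_forall_pos hν0] with a ha
      exact hb _ (admissible_stateAfter hq hτ hfull ha n) _ (ha n)
    have hupd : ∀ p : (ℕ → ℝ) × ℝ,
        F (stateAfter r q τ ⟨r + q, []⟩ (Function.update p.1 n p.2) n)
          (Function.update p.1 n p.2 n) = F (stateAfter r q τ ⟨r + q, []⟩ p.1 n) p.2 := by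
      intro p
      rw [Function.update_self, stateAfter_congr (b := p.1) _
        fun i hi => Function.update_of_ne hi.ne _ _]
    have hint' := hmp.integrable_comp_of_integrable hint
    simp only [Function.comp_def, hupd] at hint'
    nth_rw 1 [← hmp.map_eq]
    rw [integral_map hmp.measurable.aemeasurable hm.aestronglyMeasurable]
    simp only [hupd]
    exact integral_prod _ hint'
  have hrel : ∀ n, ∫ a : ℕ → ℝ, (∫ u in Set.Ioc 0 (a n),
        h ((stateAfter r q τ ⟨r + q, []⟩ a n).elapse q u)) ∂(iidLaw (expMeasure lam)) =
      1 / lam * ∫ a : ℕ → ℝ, h ((stateAfter r q τ ⟨r + q, []⟩ a n).elapse q (a n))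
        ∂(iidLaw (expMeasure lam)) := by
    intro n
    rw [hsplit (F := fun s t => h (s.elapse q t)) n (hbefore n) hbound₁,
      hsplit (F := fun s t => ∫ u in Set.Ioc 0 t, h (s.elapse q u)) n
        (hh.measurable_accrued n) hbound₂, ← integral_const_mul]
    refine integral_congr_ae ?_
    filter_upwards [ae_forall_pos hν0] with a ha
    exact integral_integral_Ioc_expMeasure hlam (hh.measurable_elapse _) (fun u => h0 _)
      fun u hu => hC _ ((admissible_stateAfter hq hτ hfull ha n).elapse hu.le)
  simp_rw [hrel] at hc'
  rw [tendsto_nhds_unique hc' (hc.const_mul (1 / lam))] at hac'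
  refine ⟨c, ?_⟩
  filter_upwards [hac, hac'] with a h1 h2 s₀ hs₀
  exact ⟨h1 s₀ hs₀, h2 s₀ hs₀⟩

end Poisson

/-! ### From customers to continuous time -/

section Time

variable {r q : ℕ} {τ lam : ℝ} {h : State → ℝ} {C : ℝ} {a : ℕ → ℝ} {s₀ : State}

lemma arrival_succ (a : ℕ → ℝ) (n : ℕ) : arrival a (n + 1) = arrival a n + a n :=
  Finset.sum_range_succ _ _

lemma strictMono_arrival (ha : ∀ n, 0 < a n) : StrictMono (arrival a) :=
  strictMono_nat_of_lt_succ fun n => by rw [arrival_succ]; linarith [ha n]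

lemma arrivals_eq (ha : ∀ n, 0 < a n) {n : ℕ} {t : ℝ} (h1 : arrival a n ≤ t)
    (h2 : t < arrival a (n + 1)) : arrivals a t = n := by
  have hm := strictMono_arrival ha
  have : {m : ℕ | arrival a (m + 1) ≤ t} = Set.Iio n := by
    ext m
    constructor
    · intro hmt
      have : arrival a (m + 1) < arrival a (n + 1) := lt_of_le_of_lt hmt h2
      have := hm.lt_iff_lt.1 this
      exact Set.mem_Iio.2 (by omega)
    · intro hmn
      exact (hm.monotone (Nat.succ_le_of_lt hmn)).trans h1
  rw [arrivals, this, ← Finset.coe_Iio, Set.ncard_coe_finset, Nat.card_Iio]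

lemma path_eq (ha : ∀ n, 0 < a n) {n : ℕ} {t : ℝ} (h1 : arrival a n ≤ t)
    (h2 : t < arrival a (n + 1)) :
    path r q τ s₀ a t = (stateAfter r q τ s₀ a n).elapse q (t - arrival a n) := by
  rw [path, arrivals_eq ha h1 h2]

/-- Renewal-reward in a deterministic form: `G` is the reward accumulated up to a point in time and
`A n` is the time of the `n`-th renewal. -/
lemma tendsto_div_of_tendsto_renewals {G : ℝ → ℝ} {A : ℕ → ℝ} {c m : ℝ} (hm : 0 < m)
    (hG0 : G 0 = 0) (hG : MonotoneOn G (Set.Ici 0)) (hA0 : A 0 = 0) (hA : StrictMono A)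
    (hAlim : Tendsto (fun n : ℕ => A n / n) atTop (𝓝 m))
    (hGlim : Tendsto (fun n : ℕ => G (A n) / n) atTop (𝓝 (m * c))) :
    Tendsto (fun T => G T / T) atTop (𝓝 c) := by
  have hAtop : Tendsto A atTop atTop := by
    have := (tendsto_natCast_atTop_atTop (R := ℝ)).atTop_mul_pos hm hAlim
    refine this.congr' ?_
    filter_upwards [eventually_gt_atTop 0] with n hn
    have : (n : ℝ) ≠ 0 := by exact_mod_cast hn.ne'
    field_simp
  have hApos : ∀ n, 0 ≤ A n := fun n => hA0 ▸ hA.monotone (Nat.zero_le n)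
  have hex : ∀ T : ℝ, ∃ n, T < A (n + 1) := fun T =>
    (((tendsto_add_atTop_iff_nat 1).2 hAtop).eventually (eventually_gt_atTop T)).exists
  classical
  set N : ℝ → ℕ := fun T => Nat.find (hex T) with hN
  have hN1 : ∀ T, T < A (N T + 1) := fun T => Nat.find_spec (hex T)
  have hN2 : ∀ T, 0 ≤ T → A (N T) ≤ T := by
    intro T hT
    rcases Nat.eq_zero_or_pos (N T) with h0 | h0
    · rw [h0, hA0]; exact hT
    · have := Nat.find_min (hex T) (m := N T - 1) (Nat.sub_lt h0 one_pos)
      rw [Nat.sub_add_cancel (show 1 ≤ N T from h0)] at this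
      exact not_lt.1 this
  have hNtop : Tendsto N atTop atTop := by
    refine tendsto_atTop.2 fun b => ?_
    filter_upwards [eventually_ge_atTop (A b)] with T hT
    have := hA.lt_iff_lt.1 (hT.trans_lt (hN1 T))
    omega
  have hratio : Tendsto (fun n : ℕ => ((n : ℝ) + 1) / n) atTop (𝓝 1) := by
    have := (tendsto_one_div_atTop_nhds_zero_nat (𝕜 := ℝ)).const_add 1
    rw [add_zero] at this
    refine this.congr' ?_
    filter_upwards [eventually_gt_atTop 0] with n hn
    have : (n : ℝ) ≠ 0 := by exact_mod_cast hn.ne'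
    field_simp
  have hA1 : Tendsto (fun n : ℕ => A (n + 1) / ((n : ℝ) + 1)) atTop (𝓝 m) := by
    simpa using (tendsto_add_atTop_iff_nat 1).2 hAlim
  have hG1 : Tendsto (fun n : ℕ => G (A (n + 1)) / ((n : ℝ) + 1)) atTop (𝓝 (m * c)) := by
    simpa using (tendsto_add_atTop_iff_nat 1).2 hGlim
  have hlow : Tendsto (fun n : ℕ => G (A n) / A (n + 1)) atTop (𝓝 c) := by
    have := (hGlim.div hA1 hm.ne').div hratio one_ne_zero
    rw [div_one, mul_div_cancel_left₀ _ hm.ne'] at this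
    refine this.congr' ?_
    filter_upwards [eventually_gt_atTop 0] with n hn
    have h1 : (n : ℝ) ≠ 0 := by exact_mod_cast hn.ne'
    have h2 : (n : ℝ) + 1 ≠ 0 := by positivity
    simp only [Pi.div_apply]
    field_simp
  have hup : Tendsto (fun n : ℕ => G (A (n + 1)) / A n) atTop (𝓝 c) := by
    have := (hG1.div hAlim hm.ne').mul hratio
    rw [mul_one, mul_div_cancel_left₀ _ hm.ne'] at this
    refine this.congr' ?_
    filter_upwards [eventually_gt_atTop 0] with n hn
    have h1 : (n : ℝ) ≠ 0 := by exact_mod_cast hn.ne'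
    have h2 : (n : ℝ) + 1 ≠ 0 := by positivity
    simp only [Pi.div_apply]
    field_simp
  have hGnn : ∀ T, 0 ≤ T → 0 ≤ G T := fun T hT =>
    hG0 ▸ hG (Set.mem_Ici.2 le_rfl) (Set.mem_Ici.2 hT) hT
  refine tendsto_of_tendsto_of_tendsto_of_le_of_le' (hlow.comp hNtop) (hup.comp hNtop) ?_ ?_
  · filter_upwards [eventually_gt_atTop 0] with T hT
    exact div_le_div₀ (hGnn T hT.le) (hG (Set.mem_Ici.2 (hApos _)) (Set.mem_Ici.2 hT.le)
      (hN2 T hT.le)) hT (hN1 T).le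
  · filter_upwards [eventually_gt_atTop 0, hNtop.eventually (eventually_gt_atTop 0)] with T hT hNT
    have hpos : 0 < A (N T) := hA0 ▸ hA hNT
    exact div_le_div₀ (hGnn _ (hApos _)) (hG (Set.mem_Ici.2 hT.le) (Set.mem_Ici.2 (hApos _))
      (hN1 T).le) hpos (hN2 T hT.le)

lemma hasLongRunAverage_of_customer_averages (hq : 0 < q) (hτ : 0 < τ) (hlam : 0 < lam)
    (hh : Observable h) (h0 : ∀ s, 0 ≤ h s) (hC : ∀ s : State, s.Admissible r q τ → h s ≤ C)
    (ha : ∀ n, 0 < a n) (hs₀ : s₀.Admissible r q τ)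
    (hgap : Tendsto (fun n : ℕ => (∑ k ∈ Finset.range n, a k) / n) atTop (𝓝 (1 / lam))) {c : ℝ}
    (havg : Tendsto (fun n : ℕ => (∑ k ∈ Finset.range n,
        ∫ u in Set.Ioc 0 (a k), h ((stateAfter r q τ s₀ a k).elapse q u)) / n)
        atTop (𝓝 (1 / lam * c))) :
    HasLongRunAverage (fun t => h (path r q τ s₀ a t)) c := by
  have hcong : ∀ n, Set.EqOn (fun t => h (path r q τ s₀ a t))
      (fun t => h ((stateAfter r q τ s₀ a n).elapse q (t - arrival a n)))
      (Set.Ioo (arrival a n) (arrival a (n + 1))) := fun n t ht => by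
    dsimp only
    rw [path_eq ha ht.1.le ht.2]
  have hle : ∀ n, arrival a n ≤ arrival a (n + 1) := fun n =>
    (strictMono_arrival ha).monotone (Nat.le_succ n)
  have hint : ∀ n, IntervalIntegrable (fun t => h (path r q τ s₀ a t)) volume
      (arrival a n) (arrival a (n + 1)) := by
    intro n
    rw [intervalIntegrable_congr_uIoo (Set.uIoo_of_le (hle n) ▸ hcong n),
      intervalIntegrable_iff_integrableOn_Ioc_of_le (hle n)]
    refine Measure.integrableOn_of_bounded (M := C) (by simp)
      ((hh.measurable_elapse _).comp (by fun_prop)).aestronglyMeasurable ?_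
    filter_upwards [ae_restrict_mem measurableSet_Ioc] with u hu
    rw [Real.norm_of_nonneg (h0 _)]
    exact hC _ ((admissible_stateAfter hq hτ hs₀ ha n).elapse (by linarith [hu.1]))
  have hval : ∀ n, ∫ t in (arrival a n)..(arrival a (n + 1)), h (path r q τ s₀ a t) =
      ∫ u in Set.Ioc 0 (a n), h ((stateAfter r q τ s₀ a n).elapse q u) := by
    intro n
    rw [intervalIntegral.integral_congr_Ioo_of_le (hle n) (hcong n),
      intervalIntegral.integral_comp_sub_right
        (fun u => h ((stateAfter r q τ s₀ a n).elapse q u)) (arrival a n), sub_self, arrival_succ,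
      add_sub_cancel_left, intervalIntegral.integral_of_le (ha n).le]
  have hzero : arrival a 0 = 0 := by simp [arrival]
  have hintn : ∀ n, IntervalIntegrable (fun t => h (path r q τ s₀ a t)) volume 0
      (arrival a n) := fun n => by
    have := IntervalIntegrable.trans_iterate (n := n) fun k _ => hint k
    rwa [hzero] at this
  have hAtop : Tendsto (arrival a) atTop atTop := by
    have := (tendsto_natCast_atTop_atTop (R := ℝ)).atTop_mul_pos (one_div_pos.2 hlam) hgap
    refine this.congr' ?_
    filter_upwards [eventually_gt_atTop 0] with n hn
    have : (n : ℝ) ≠ 0 := by exact_mod_cast hn.ne'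
    rw [arrival]
    field_simp
  have hintT : ∀ T, 0 ≤ T →
      IntervalIntegrable (fun t => h (path r q τ s₀ a t)) volume 0 T := by
    intro T hT
    obtain ⟨n, hn⟩ := (hAtop.eventually (eventually_ge_atTop T)).exists
    refine (hintn n).mono_set ?_
    rw [Set.uIcc_of_le hT, Set.uIcc_of_le (hT.trans hn)]
    exact Set.Icc_subset_Icc_right hn
  refine ⟨hintT, ?_⟩
  have hmono : MonotoneOn (fun T => ∫ t in (0 : ℝ)..T, h (path r q τ s₀ a t)) (Set.Ici 0) := by
    intro S hS T hT hST
    have := intervalIntegral.integral_interval_sub_left (hintT T hT) (hintT S hS)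
    have h2 : 0 ≤ ∫ t in S..T, h (path r q τ s₀ a t) :=
      intervalIntegral.integral_nonneg hST fun t _ => h0 _
    dsimp only
    linarith
  have := tendsto_div_of_tendsto_renewals (G := fun T => ∫ t in (0 : ℝ)..T, h (path r q τ s₀ a t))
    (A := arrival a) (one_div_pos.2 hlam) (by simp) hmono hzero (strictMono_arrival ha) hgap
    (c := c) (by
      refine havg.congr fun n => ?_
      have := intervalIntegral.sum_integral_adjacent_intervals (n := n) fun k _ => hint k
      rw [hzero] at this
      rw [← this, Finset.sum_congr rfl fun k _ => hval k])
  refine this.congr fun T => ?_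
  rw [div_eq_mul_one_div, mul_comm]

end Time

/-! ### The relations between the averages -/

section Balance

variable {r q : ℕ} {τ lam : ℝ}

lemma observable_of_counts (f : ℕ × ℕ → ℝ) :
    Observable fun s => f (s.onHand, s.outstanding.length) := fun _ hS =>
  (Measurable.of_discrete (f := f)).comp (hS.onHand.prodMk hS.length)

/-- Indicator of a stockout. -/
noncomputable def stockout (s : State) : ℝ := if s.onHand = 0 then 1 else 0

/-- Indicator of having stock on hand while the inventory position is `j`. -/
noncomputable def stockAt (q j : ℕ) (s : State) : ℝ :=
  if s.onHand ≠ 0 ∧ s.position q = j then 1 else 0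

lemma observable_stockout : Observable stockout :=
  observable_of_counts fun p => if p.1 = 0 then 1 else 0

lemma observable_stockAt (j : ℕ) : Observable (stockAt q j) :=
  observable_of_counts fun p => if p.1 ≠ 0 ∧ p.1 + q * p.2 = j then 1 else 0

lemma observable_onHand : Observable fun s => (s.onHand : ℝ) :=
  observable_of_counts fun p => p.1

lemma observable_position : Observable fun s => (s.position q : ℝ) :=
  observable_of_counts fun p => ((p.1 + q * p.2 : ℕ) : ℝ)

lemma observable_onOrder : Observable fun s => (s.onOrder q : ℝ) :=
  observable_of_counts fun p => ((q * p.2 : ℕ) : ℝ)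

lemma stockout_add_sum_stockAt {s : State} (hs : s.Admissible r q τ) :
    stockout s + ∑ i ∈ Finset.range q, stockAt q (r + 1 + i) s = 1 := by
  by_cases h0 : s.onHand = 0
  · simp [stockout, stockAt, h0]
  · obtain ⟨h1, h2, -⟩ := hs
    obtain ⟨i, hi⟩ := Nat.exists_eq_add_of_le (show r + 1 ≤ s.position q from h1)
    have : i ∈ Finset.range q := Finset.mem_range.2 (by omega)
    simp [stockout, stockAt, h0, hi, Finset.sum_ite_eq, this]

lemma position_eq_sum {s : State} (hs : s.Admissible r q τ) :
    (s.position q : ℝ) = ((q * ((r + q) / q) : ℕ) : ℝ) * stockout s +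
      ∑ i ∈ Finset.range q, ((r : ℝ) + 1 + i) * stockAt q (r + 1 + i) s := by
  by_cases h0 : s.onHand = 0
  · simp [stockout, stockAt, h0, position_of_onHand_eq_zero hs h0]
  · obtain ⟨h1, h2, -⟩ := hs
    obtain ⟨i, hi⟩ := Nat.exists_eq_add_of_le (show r + 1 ≤ s.position q from h1)
    have : i ∈ Finset.range q := Finset.mem_range.2 (by omega)
    simp [stockout, stockAt, h0, hi, Finset.sum_ite_eq, this]

/-- Level crossing between the inventory positions `j + 1` and `j`. -/
lemma crossing_demand {s : State} (hs : s.Admissible r q τ) {j : ℕ} (hj : r < j)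
    (hj' : j < r + q) :
    (if (s.demand r q τ).position q = j then (1 : ℝ) else 0) =
      (if s.position q = j then 1 else 0) + stockAt q (j + 1) s - stockAt q j s := by
  rw [position_demand hs]
  obtain ⟨h1, h2, -⟩ := hs
  unfold stockAt
  by_cases h0 : s.onHand = 0
  · simp [h0]
  · by_cases hp : s.position q = r + 1
    · rw [if_neg h0, if_pos hp]
      by_cases hpj : s.position q = j
      · simp [h0, hpj, hj'.ne']
      · have e1 : s.position q ≠ j + 1 := by omega
        simp [h0, hpj, hj'.ne', e1]
    · rw [if_neg h0, if_neg hp]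
      by_cases hpj : s.position q = j
      · have e1 : j - 1 ≠ j := by omega
        simp [h0, hpj, e1]
      · by_cases hpj' : s.position q = j + 1
        · simp [h0, hpj']
        · have e1 : s.position q - 1 ≠ j := by omega
          simp [h0, hpj, hpj', e1]

/-- Inputs and outputs of a bounded store have the same averages. -/
lemma average_eq_of_balance {V x y : ℕ → ℝ} {B c c' : ℝ} (hV : ∀ n, |V n| ≤ B)
    (hbal : ∀ n, V (n + 1) = V n + x n - y n)
    (hx : Tendsto (fun n : ℕ => (∑ k ∈ Finset.range n, x k) / n) atTop (𝓝 c))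
    (hy : Tendsto (fun n : ℕ => (∑ k ∈ Finset.range n, y k) / n) atTop (𝓝 c')) : c = c' := by
  have hsum : ∀ n, ∑ k ∈ Finset.range n, x k - ∑ k ∈ Finset.range n, y k = V n - V 0 := by
    intro n
    rw [← Finset.sum_range_sub V n, ← Finset.sum_sub_distrib]
    exact Finset.sum_congr rfl fun k _ => by rw [hbal k]; ring
  have h1 := hx.sub hy
  have h2 : Tendsto (fun n : ℕ => (∑ k ∈ Finset.range n, x k) / n -
      (∑ k ∈ Finset.range n, y k) / n) atTop (𝓝 0) := by
    refine squeeze_zero_norm (fun n => ?_) (tendsto_const_div_atTop_nhds_zero_nat (2 * B))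
    rw [← sub_div, hsum, Real.norm_eq_abs, abs_div, Nat.abs_cast]
    gcongr
    refine (abs_sub _ _).trans ?_
    linarith [hV n, hV 0]
  exact sub_eq_zero.1 (tendsto_nhds_unique h1 h2)

/-- The total remaining lead time of the outstanding orders. -/
def State.remaining (s : State) : ℝ := s.outstanding.sum

lemma setIntegral_Ioc_ite_lt {y t : ℝ} (hy : 0 < y) (ht : 0 ≤ t) :
    ∫ u in Set.Ioc 0 t, (if u < y then (1 : ℝ) else 0) = y - if t < y then y - t else 0 := by
  have h1 : (fun u : ℝ => if u < y then (1 : ℝ) else 0) =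
      (Set.Iio y).indicator fun _ => (1 : ℝ) := by
    ext u
    simp [Set.indicator]
  rw [h1, setIntegral_indicator measurableSet_Iio, setIntegral_const, smul_eq_mul, mul_one,
    measureReal_def]
  split_ifs with h
  · have : Set.Ioc 0 t ∩ Set.Iio y = Set.Ioc 0 t :=
      Set.inter_eq_left.2 fun u hu => lt_of_le_of_lt hu.2 h
    rw [this, Real.volume_Ioc, ENNReal.toReal_ofReal (by linarith)]
    ring
  · have : Set.Ioc 0 t ∩ Set.Iio y = Set.Ioo 0 y := by
      ext u
      simp only [Set.mem_inter_iff, Set.mem_Ioc, Set.mem_Iio, Set.mem_Ioo]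
      constructor
      · rintro ⟨⟨h1, -⟩, h2⟩; exact ⟨h1, h2⟩
      · rintro ⟨h1, h2⟩; exact ⟨⟨h1, by linarith⟩, h2⟩
    rw [this, Real.volume_Ioo, ENNReal.toReal_ofReal (by linarith)]

/-- Between two customers, the total remaining lead time decreases at a rate equal to the number of
outstanding orders. -/
lemma setIntegral_length_elapse {s : State} (hs : ∀ y ∈ s.outstanding, 0 < y) {t : ℝ}
    (ht : 0 ≤ t) :
    ∫ u in Set.Ioc 0 t, ((s.elapse q u).outstanding.length : ℝ) =
      s.remaining - (s.elapse q t).remaining := by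
  have key : ∀ l : List ℝ, (∀ y ∈ l, 0 < y) →
      IntegrableOn (fun u => ((l.filter fun y => decide (u < y)).length : ℝ)) (Set.Ioc 0 t) ∧
      ∫ u in Set.Ioc 0 t, ((l.filter fun y => decide (u < y)).length : ℝ) =
        l.sum - ((l.filter fun y => decide (t < y)).map fun y => y - t).sum := by
    intro l hl
    induction l with
    | nil => simp
    | cons y l ih =>
      obtain ⟨ih1, ih2⟩ := ih fun z hz => hl z (List.mem_cons_of_mem _ hz)
      have hy : 0 < y := hl y List.mem_cons_self
      have hfun : (fun u => (((y :: l).filter fun z => decide (u < z)).length : ℝ)) =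
          fun u => (if u < y then (1 : ℝ) else 0) +
            ((l.filter fun z => decide (u < z)).length : ℝ) := by
        ext u
        by_cases h : u < y <;> simp [h, add_comm]
      have hint : IntegrableOn (fun u : ℝ => if u < y then (1 : ℝ) else 0) (Set.Ioc 0 t) := by
        refine Measure.integrableOn_of_bounded (M := 1) (by simp)
          (Measurable.ite measurableSet_Iio measurable_const
            measurable_const).aestronglyMeasurable ?_
        refine Eventually.of_forall fun u => ?_
        split_ifs <;> simp
      rw [hfun]
      refine ⟨hint.add ih1, ?_⟩
      rw [integral_add hint ih1, ih2, setIntegral_Ioc_ite_lt hy ht]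
      by_cases h : t < y
      · simp [h]; ring
      · simp [h]; ring
  simpa [State.remaining, State.elapse] using (key s.outstanding hs).2

lemma remaining_demand {s : State} (hs : s.Admissible r q τ) :
    (s.demand r q τ).remaining = s.remaining + τ * stockAt q (r + 1) s := by
  obtain ⟨h1, h2, -⟩ := hs
  unfold State.demand stockAt State.remaining
  by_cases h0 : s.onHand = 0
  · simp [h0]
  · by_cases hp : s.position q = r + 1
    · simp [h0, hp]
    · have : ¬ s.position q - 1 ≤ r := by omega
      simp [h0, hp, this]

lemma abs_remaining_le (hq : 0 < q) (hτ : 0 < τ) {s : State} (hs : s.Admissible r q τ) :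
    |s.remaining| ≤ (r + q) * τ := by
  have h0 : 0 ≤ s.remaining := List.sum_nonneg fun y hy => (hs.2.2 y hy).1.le
  have h1 : s.remaining ≤ s.outstanding.length • τ :=
    List.sum_le_card_nsmul _ _ fun y hy => (hs.2.2 y hy).2
  have h2 : s.outstanding.length ≤ r + q :=
    (Nat.le_mul_of_pos_left _ hq).trans (onOrder_le hs)
  have h3 : (s.outstanding.length : ℝ) ≤ r + q := by exact_mod_cast h2
  rw [abs_of_nonneg h0]
  refine h1.trans ?_
  rw [nsmul_eq_mul]
  exact mul_le_mul_of_nonneg_right h3 hτ.le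

lemma stockoutPosition_eq : stockoutPosition r q = ((q * ((r + q) / q) : ℕ) : ℝ) := by
  have h : ⌊((r : ℝ) + q) / q⌋ = (((r + q) / q : ℕ) : ℤ) := by
    rw [Int.floor_div_natCast, ← Nat.cast_add, Int.floor_natCast]
    push_cast
    rfl
  rw [stockoutPosition, h]
  push_cast
  rfl

/-- The relations between the averages over the customers on one sample path. -/
lemma relations_of_averages (hq : 0 < q) (hτ : 0 < τ) (hlam : 0 < lam) {a : ℕ → ℝ}
    (ha : ∀ n, 0 < a n) {s₀ : State} (hs₀ : s₀.Admissible r q τ) {γ L P U : ℝ} {α : ℕ → ℝ}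
    (hγ : Tendsto (fun n : ℕ => (∑ k ∈ Finset.range n, stockout (stateBefore r q τ s₀ a k)) / n)
      atTop (𝓝 γ))
    (hα : ∀ j, Tendsto (fun n : ℕ => (∑ k ∈ Finset.range n,
      stockAt q j (stateBefore r q τ s₀ a k)) / n) atTop (𝓝 (α j)))
    (hL : Tendsto (fun n : ℕ => (∑ k ∈ Finset.range n,
      ((stateBefore r q τ s₀ a k).onHand : ℝ)) / n) atTop (𝓝 L))
    (hP : Tendsto (fun n : ℕ => (∑ k ∈ Finset.range n,
      ((stateBefore r q τ s₀ a k).position q : ℝ)) / n) atTop (𝓝 P))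
    (hU : Tendsto (fun n : ℕ => (∑ k ∈ Finset.range n,
      ((stateBefore r q τ s₀ a k).onOrder q : ℝ)) / n) atTop (𝓝 U))
    (hU' : Tendsto (fun n : ℕ => (∑ k ∈ Finset.range n, ∫ u in Set.Ioc 0 (a k),
      (((stateAfter r q τ s₀ a k).elapse q u).onOrder q : ℝ)) / n) atTop (𝓝 (1 / lam * U))) :
    Relations r q (lam * τ) γ L P U := by
  have hadm := admissible_stateBefore hq hτ hs₀ ha
  have hLU : L + U = P := by
    refine tendsto_nhds_unique (hL.add hU) (hP.congr fun n => ?_)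
    rw [← add_div, ← Finset.sum_add_distrib]
    simp [State.position]
  have hone : γ + ∑ i ∈ Finset.range q, α (r + 1 + i) = 1 := by
    have hsum := tendsto_finsetSum (Finset.range q) fun i _ => hα (r + 1 + i)
    refine tendsto_nhds_unique (hγ.add hsum) ?_
    refine tendsto_const_nhds.congr' ?_
    filter_upwards [eventually_gt_atTop 0] with n hn
    have hn' : (n : ℝ) ≠ 0 := by exact_mod_cast hn.ne'
    rw [← Finset.sum_div, ← add_div, Finset.sum_comm, ← Finset.sum_add_distrib,
      Finset.sum_congr rfl fun k _ => stockout_add_sum_stockAt (hadm k)]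
    simp [hn']
  have hpos : P = ((q * ((r + q) / q) : ℕ) : ℝ) * γ +
      ∑ i ∈ Finset.range q, ((r : ℝ) + 1 + i) * α (r + 1 + i) := by
    have hsum := tendsto_finsetSum (Finset.range q) fun i _ =>
      (hα (r + 1 + i)).const_mul ((r : ℝ) + 1 + i)
    refine tendsto_nhds_unique hP (((hγ.const_mul _).add hsum).congr fun n => ?_)
    have hcomm : ∑ i ∈ Finset.range q, ((r : ℝ) + 1 + i) * ((∑ k ∈ Finset.range n,
        stockAt q (r + 1 + i) (stateBefore r q τ s₀ a k)) / n) =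
        (∑ k ∈ Finset.range n, ∑ i ∈ Finset.range q, ((r : ℝ) + 1 + i) *
          stockAt q (r + 1 + i) (stateBefore r q τ s₀ a k)) / n := by
      rw [Finset.sum_comm, Finset.sum_div]
      exact Finset.sum_congr rfl fun i _ => by rw [← Finset.mul_sum, mul_div_assoc]
    rw [hcomm, Finset.sum_congr rfl fun k _ => position_eq_sum (hadm k), Finset.sum_add_distrib,
      add_div, ← Finset.mul_sum, mul_div_assoc]
  have hstep : ∀ i, i < q → α (r + 1 + i) = α (r + 1) := by
    intro i hi
    induction i with
    | zero => rfl
    | succ i ih =>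
      rw [← ih (by omega)]
      refine average_eq_of_balance (B := 1)
        (V := fun n => if (stateAfter r q τ s₀ a n).position q = r + 1 + i then 1 else 0)
        (fun n => by split_ifs <;> simp) (fun n => ?_) (hα (r + 1 + i + 1)) (hα (r + 1 + i))
      have := crossing_demand (hadm n) (j := r + 1 + i) (by omega) (by omega)
      rw [stateAfter_succ, this, stateBefore, position_elapse]
  have hsumα : ∀ f : ℕ → ℝ, ∑ i ∈ Finset.range q, f i * α (r + 1 + i) =
      (∑ i ∈ Finset.range q, f i) * α (r + 1) := fun f => by
    rw [Finset.sum_mul]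
    exact Finset.sum_congr rfl fun i hi => by rw [hstep i (Finset.mem_range.1 hi)]
  have hqα : γ + q * α (r + 1) = 1 := by
    have := hsumα fun _ => 1
    simp only [one_mul, Finset.sum_const, Finset.card_range, nsmul_eq_mul, mul_one] at this
    rw [← this]; exact hone
  have hgauss : ∀ n : ℕ, ∑ i ∈ Finset.range n, ((r : ℝ) + 1 + i) = n * (r + (n + 1) / 2) := by
    intro n
    induction n with
    | zero => simp
    | succ n ih => rw [Finset.sum_range_succ, ih]; push_cast; ring
  rw [hsumα, hgauss, ← stockoutPosition_eq] at hpos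
  -- Little's law: orders bring in lead time, which runs off at a rate equal to their number
  have hlittle : τ * α (r + 1) = 1 / q * (1 / lam * U) := by
    have hx : Tendsto (fun n : ℕ => (∑ k ∈ Finset.range n,
        τ * stockAt q (r + 1) (stateBefore r q τ s₀ a k)) / n) atTop (𝓝 (τ * α (r + 1))) := by
      refine ((hα (r + 1)).const_mul τ).congr fun n => ?_
      rw [← Finset.mul_sum, mul_div_assoc]
    have hy : Tendsto (fun n : ℕ => (∑ k ∈ Finset.range n, ∫ u in Set.Ioc 0 (a k),
        (((stateAfter r q τ s₀ a k).elapse q u).outstanding.length : ℝ)) / n) atTop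
        (𝓝 (1 / q * (1 / lam * U))) := by
      have hq' : (q : ℝ) ≠ 0 := by exact_mod_cast hq.ne'
      refine (hU'.const_mul (1 / (q : ℝ))).congr fun n => ?_
      simp only [State.onOrder, Nat.cast_mul, integral_const_mul]
      rw [← Finset.mul_sum]
      field_simp
    refine average_eq_of_balance (V := fun n => (stateAfter r q τ s₀ a n).remaining)
      (fun n => abs_remaining_le hq hτ (admissible_stateAfter hq hτ hs₀ ha n)) (fun n => ?_) hx hy
    rw [stateAfter_succ, remaining_demand (hadm n), setIntegral_length_elapse
      (fun y hy => ((admissible_stateAfter hq hτ hs₀ ha n).2.2 y hy).1) (ha n).le, stateBefore]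
    ring
  have hq' : (q : ℝ) ≠ 0 := by exact_mod_cast hq.ne'
  have hqα' : (q : ℝ) * α (r + 1) = 1 - γ := by linarith
  have hUx : U = (1 - γ) * (lam * τ) := by
    rw [← hqα']
    field_simp at hlittle
    linarith
  have hPx : P = (1 - γ) * meanPosition r q + γ * stockoutPosition r q := by
    rw [← hqα', hpos, meanPosition]
    ring
  refine ⟨hPx, by linarith, hUx, ?_⟩
  have : L = P - U := by linarith
  rw [this, hPx, hUx]
  ring

/-- The four quantities depend affinely on the stockout fraction, and each determines the others
where it is not constant. -/
lemma relations_determine {r q : ℕ} {x : ℝ} (hx : x ≠ 0) {γ L P U γ' L' P' U' : ℝ}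
    (h : Relations r q x γ L P U) (h' : Relations r q x γ' L' P' U') :
    (γ' = γ → L' = L ∧ P' = P ∧ U' = U) ∧
    (U' = U → γ' = γ ∧ L' = L ∧ P' = P) ∧
    (meanPosition r q ≠ stockoutPosition r q → P' = P → γ' = γ ∧ L' = L ∧ U' = U) ∧
    (meanPosition r q - x ≠ stockoutPosition r q → L' = L → γ' = γ ∧ P' = P ∧ U' = U) := by
  obtain ⟨hP, -, hU, hL⟩ := h
  obtain ⟨hP', -, hU', hL'⟩ := h'
  have hγ : γ' = γ → L' = L ∧ P' = P ∧ U' = U := by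
    rintro rfl
    exact ⟨hL'.trans hL.symm, hP'.trans hP.symm, hU'.trans hU.symm⟩
  refine ⟨hγ, fun hUU => ?_, fun hne hPP => ?_, fun hne hLL => ?_⟩
  · have : γ' = γ := by
      have := mul_right_cancel₀ hx (hU'.symm.trans (hUU.trans hU))
      linarith
    exact ⟨this, (hγ this).1, (hγ this).2.1⟩
  · have : γ' = γ := by
      refine mul_right_cancel₀ (sub_ne_zero.2 hne) ?_
      linarith [hP'.symm.trans (hPP.trans hP)]
    exact ⟨this, (hγ this).1, (hγ this).2.2⟩
  · have : γ' = γ := by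
      refine mul_right_cancel₀ (sub_ne_zero.2 hne) ?_
      linarith [hL'.symm.trans (hLL.trans hL)]
    exact ⟨this, (hγ this).2.1, (hγ this).2.2⟩

end Balance

/-- On almost every sequence of interarrival times the long-run averages exist from every initial
state, and they satisfy the four relations. -/
lemma exists_longRunAverages {r q : ℕ} (hq : 0 < q) {lam τ : ℝ} (hlam : 0 < lam) (hτ : 0 < τ) :
    ∃ γ L P U : ℝ, Relations r q (lam * τ) γ L P U ∧
      ∀ᵐ a ∂(iidLaw (expMeasure lam)), ∀ s₀ : State, s₀.Admissible r q τ →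
        HasLongRunAverage (fun t => stockout (path r q τ s₀ a t)) γ ∧
        HasLongRunAverage (fun t => ((path r q τ s₀ a t).onHand : ℝ)) L ∧
        HasLongRunAverage (fun t => ((path r q τ s₀ a t).position q : ℝ)) P ∧
        HasLongRunAverage (fun t => ((path r q τ s₀ a t).onOrder q : ℝ)) U := by
  have := isProbabilityMeasure_expMeasure hlam
  have hγ0 : ∀ s, 0 ≤ stockout s := fun s => by unfold stockout; split_ifs <;> simp
  have hγC : ∀ s : State, s.Admissible r q τ → stockout s ≤ 1 := fun s _ => by
    unfold stockout; split_ifs <;> simp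
  have hα0 : ∀ j s, 0 ≤ stockAt q j s := fun j s => by unfold stockAt; split_ifs <;> simp
  have hαC : ∀ j, ∀ s : State, s.Admissible r q τ → stockAt q j s ≤ 1 := fun j s _ => by
    unfold stockAt; split_ifs <;> simp
  have hLC : ∀ s : State, s.Admissible r q τ → (s.onHand : ℝ) ≤ r + q := fun s hs => by
    exact_mod_cast onHand_le hs
  have hPC : ∀ s : State, s.Admissible r q τ → (s.position q : ℝ) ≤ r + q := fun s hs => by
    exact_mod_cast hs.2.1
  have hUC : ∀ s : State, s.Admissible r q τ → (s.onOrder q : ℝ) ≤ r + q := fun s hs => by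
    exact_mod_cast onOrder_le hs
  obtain ⟨c, hc⟩ := exists_average_of_observable (r := r) (h := fun _ => 1) hq hτ hlam
    (observable_of_counts fun _ => 1) (fun _ => zero_le_one) (C := 1) fun _ _ => le_rfl
  obtain ⟨γ, hγ⟩ := exists_average_of_observable hq hτ hlam observable_stockout hγ0 hγC
  choose α hα using fun j =>
    exists_average_of_observable hq hτ hlam (observable_stockAt j) (hα0 j) (hαC j)
  obtain ⟨L, hL⟩ := exists_average_of_observable hq hτ hlam observable_onHand
    (fun s => Nat.cast_nonneg _) hLC
  obtain ⟨P, hP⟩ := exists_average_of_observable hq hτ hlam observable_position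
    (fun s => Nat.cast_nonneg _) hPC
  obtain ⟨U, hU⟩ := exists_average_of_observable hq hτ hlam observable_onOrder
    (fun s => Nat.cast_nonneg _) hUC
  have hpos := ae_forall_pos (ae_pos_expMeasure hlam)
  refine ⟨γ, L, P, U, ?_, ?_⟩
  · obtain ⟨a, ha, haγ, haα, haL, haP, haU⟩ :=
      (hpos.and (hγ.and ((ae_all_iff.2 hα).and (hL.and (hP.and hU))))).exists
    have hs₀ := admissible_full (r := r) (τ := τ) hq
    exact relations_of_averages hq hτ hlam ha hs₀ (haγ _ hs₀).1 (fun j => (haα j _ hs₀).1)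
      (haL _ hs₀).1 (haP _ hs₀).1 (haU _ hs₀).1 (haU _ hs₀).2
  · filter_upwards [hpos, hc, hγ, hL, hP, hU] with a ha hac haγ haL haP haU s₀ hs₀
    have hgap : Tendsto (fun n : ℕ => (∑ k ∈ Finset.range n, a k) / n) atTop (𝓝 (1 / lam)) := by
      obtain ⟨h1, h2⟩ := hac s₀ hs₀
      have hc1 : c = 1 := by
        refine tendsto_nhds_unique h1 (tendsto_const_nhds.congr' ?_)
        filter_upwards [eventually_gt_atTop 0] with n hn
        have hn' : (n : ℝ) ≠ 0 := by exact_mod_cast hn.ne'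
        simp [hn']
      rw [hc1, mul_one] at h2
      refine h2.congr fun n => ?_
      congr 1
      refine Finset.sum_congr rfl fun k _ => ?_
      simp [(ha k).le]
    exact ⟨hasLongRunAverage_of_customer_averages hq hτ hlam observable_stockout hγ0 hγC ha hs₀
        hgap (haγ s₀ hs₀).2,
      hasLongRunAverage_of_customer_averages hq hτ hlam observable_onHand
        (fun s => Nat.cast_nonneg _) hLC ha hs₀ hgap (haL s₀ hs₀).2,
      hasLongRunAverage_of_customer_averages hq hτ hlam observable_position
        (fun s => Nat.cast_nonneg _) hPC ha hs₀ hgap (haP s₀ hs₀).2,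
      hasLongRunAverage_of_customer_averages hq hτ hlam observable_onOrder
        (fun s => Nat.cast_nonneg _) hUC ha hs₀ hgap (haU s₀ hs₀).2⟩

end LostSales

theorem theorem1 (r q : ℕ) (hq : 0 < q) (lam τ : ℝ) (hlam : 0 < lam) (hτ : 0 < τ) :
    ∃ γ L P U : ℝ,
      -- `γ`, `L`, `P`, `U` are the long run averages of the system, from any initial state
      (∀ (Ω : Type*) [MeasurableSpace Ω] (μ : Measure Ω) [IsProbabilityMeasure μ]
          (X : ℕ → Ω → ℝ), LostSales.IsPoissonDemand μ lam X →
        ∀ᵐ ω ∂μ, ∀ s₀ : LostSales.State, s₀.Admissible r q τ →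
          LostSales.HasLongRunAverage (fun t =>
            if (LostSales.path r q τ s₀ (fun n => X n ω) t).onHand = 0 then 1 else 0) γ ∧
          LostSales.HasLongRunAverage (fun t =>
            ((LostSales.path r q τ s₀ (fun n => X n ω) t).onHand : ℝ)) L ∧
          LostSales.HasLongRunAverage (fun t =>
            ((LostSales.path r q τ s₀ (fun n => X n ω) t).position q : ℝ)) P ∧
          LostSales.HasLongRunAverage (fun t =>
            ((LostSales.path r q τ s₀ (fun n => X n ω) t).onOrder q : ℝ)) U) ∧
      -- the four relations
      LostSales.Relations r q (lam * τ) γ L P U ∧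
      -- through the relations, each of the four quantities determines the other three
      (∀ γ' L' P' U' : ℝ, LostSales.Relations r q (lam * τ) γ' L' P' U' →
        (γ' = γ → L' = L ∧ P' = P ∧ U' = U) ∧
        (U' = U → γ' = γ ∧ L' = L ∧ P' = P) ∧
        (LostSales.meanPosition r q ≠ LostSales.stockoutPosition r q →
          P' = P → γ' = γ ∧ L' = L ∧ U' = U) ∧
        (LostSales.meanPosition r q - lam * τ ≠ LostSales.stockoutPosition r q →
          L' = L → γ' = γ ∧ P' = P ∧ U' = U)) := by
  obtain ⟨γ, L, P, U, hrel, hav⟩ := LostSales.exists_longRunAverages (r := r) hq hlam hτ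
  refine ⟨γ, L, P, U, ?_, hrel, fun γ' L' P' U' h' =>
    LostSales.relations_determine (mul_pos hlam hτ).ne' hrel h'⟩
  intro Ω _ μ _ X hX
  have hlaw := hX.indep.hasLaw_infinitePi hX.hasLaw
    (aemeasurable_pi_iff.2 fun n => (hX.hasLaw n).aemeasurable)
  exact ae_of_ae_map hlaw.aemeasurable (by rw [hlaw.map_eq]; exact hav)
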